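/- Let $(W,S)$ be a Coxeter system with length function $l$, and let $S\to I$, $s\mapsto i(s)$, be a function with $i(s)=i(s')$ whenever $s,s'$ are conjugate in $W$. For $\mathbf q=(q_j)_{j\in I}\in(0,\infty)^I$ write $q_s=q_{i(s)}$ and $q_w=q_{s_1}\cdots q_{s_l}$ for a reduced expression $w=s_1\cdots s_l$. For $T\subseteq S$ let $W_T$ be the subgroup generated by $T$, and let $W_T(\mathbf q)=\sum_{w\in W_T}q_w$ if $W_T$ is finite. Let $L^2_{\mathbf q}$ be the real Hilbert space with orthogonal basis $(e_w)_{w\in W}$, $\langle e_w,e_w\rangle_{\mathbf q}=q_w$. The Hecke algebra $\mathbf R_{\mathbf q}[W]$ acts on it from the left by $e_se_w=e_{sw}$ if $l(sw)>l(w)$ and $e_se_w=q_se_{sw}+(q_s-1)e_w$ if $l(sw)<l(w)$. A Hilbert $\mathcal N_{\mathbf q}$-module is a closed subspace $V$ of a finite orthogonal sum $\bigoplus_{j\in J}L^2_{\mathbf q}$ that is stable under the diagonal left action of $\mathbf R_{\mathbf q}[W]$; its von Neumann dimension is $\dim_{\mathcal N_{\mathbf q}}V=\sum_{j\in J}\langle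 p_V(e_1^j),e_1^j\rangle_{\mathbf q}$, where $p_V$ is the orthogonal projection onto $V$ and $e_1^j$ is the vector $e_1$ in the $j$-th summand. Let $Z$ be a finite CW complex with a family of subcomplexes $(Z_s)_{s\in S}$ such that $Z\cap\bigcap_{s\in T}Z_s=\emptyset$ whenever $W_T$ is infinite. For a cell $c$ of $Z$ put $S(c)=\{s\in S: c\subseteq Z_s\}$. Let $\mathcal U=\mathcal U(W,Z)=(W\times Z)/\!\sim$, where $(w,z)\sim(w',z')$ iff $z=z'$ and $w^{-1}w'$ lies in the subgroup generated by $\{s: z\in Z_s\}$. It is a CW complex with cells $wc$ ($w\in W$, $c$ a cell of $Z$), where $wc=w'c$ iff $wW_{S(c)}=w'W_{S(c)}$. Orient the cells of $Z$ arbitrarily and let $wc$ carry the orientation translated from $c$. Put $\mu_{\mathbf q}(wc)=q_u$, where $u$ is the shortest element of $wW_{S(c)}$, and let $L^2_{\mathbf q}C^n(\mathcal U)=L^2(\mathcal U^{(n)},\mu_{\mathbf q})$, where $\mathcal U^{(n)}$ is the set of $n$-cells, with the cellular coboundary $\delta^n f(\gamma)=\sum_\beta[\beta:\gamma]f(\beta)$.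 The reduced cohomology $L^2_{\mathbf q}\mathcal H^n(\mathcal U)=\operatorname{Ker}\delta^n/\overline{\operatorname{Im}\delta^{n-1}}$ is identified with the orthogonal complement of $\operatorname{Im}\delta^{n-1}$ in $\operatorname{Ker}\delta^n$, and is embedded in $\bigoplus_{c\in Z^{(n)}}L^2_{\mathbf q}$, where $Z^{(n)}$ is the set of $n$-cells of $Z$, by the isometry $\Phi$ for which the coefficient of the $c$-component of $\Phi(f)$ at $e_w$ is $f(wc)/\sqrt{W_{S(c)}(\mathbf q)}$. Then, for each $n\ge 0$, the image of $L^2_{\mathbf q}\mathcal H^n(\mathcal U)$ under $\Phi$ is a Hilbert $\mathcal N_{\mathbf q}$-module for every $\mathbf q\in(0,\infty)^I$, and its von Neumann dimension, the $n$-th $L^2_{\mathbf q}$-Betti number $b^n_{\mathbf q}(\mathcal U)$, is a continuous function of $\mathbf q\in(0,\infty)^I$ (with the product topology). -/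

import Mathlib

open Topology

/-! ### Weighted `L²`-spaces of functions on a discrete set -/

section WeightedL2

variable {ι : Type*}

/-- The real Hilbert space `L²(ι, μ)` of functions `f` on the discrete set `ι` with
`∑ c, f c ^ 2 * μ c < ∞`, where `μ : ι → ℝ` is a positive weight.  It is presented by coordinates
in the orthonormal basis `e_c / √(μ c)`, where `e_c` is the indicator function of `c`.  The
function that underlies `x : WeightedL2 μ` is `WeightedL2.coeff μ x`. -/
abbrev WeightedL2 (_μ : ι → ℝ) : Type _ := lp (fun _ : ι => ℝ) 2

namespace WeightedL2

/-- The function on `ι` underlying an element of `L²(ι, μ)`. -/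
noncomputable def coeff (μ : ι → ℝ) (x : WeightedL2 μ) (c : ι) : ℝ :=
  (x : ∀ _ : ι, ℝ) c / √(μ c)

/-- The indicator function `e_c` of the point `c`, as an element of `L²(ι, μ)`. -/
noncomputable def basisVec (μ : ι → ℝ) (c : ι) : WeightedL2 μ :=
  open Classical in lp.single 2 c (√(μ c))

theorem coeff_add (μ : ι → ℝ) (x y : WeightedL2 μ) (c : ι) :
    coeff μ (x + y) c = coeff μ x c + coeff μ y c := by
  simp [coeff, add_div]

theorem coeff_smul (μ : ι → ℝ) (a : ℝ) (x : WeightedL2 μ) (c : ι) :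
    coeff μ (a • x) c = a * coeff μ x c := by
  simp [coeff, mul_div_assoc]

theorem coeff_zero (μ : ι → ℝ) (c : ι) : coeff μ (0 : WeightedL2 μ) c = 0 := by
  simp [coeff]

theorem coeff_basisVec [DecidableEq ι] (μ : ι → ℝ) (hμ : ∀ c, 0 < μ c) (c d : ι) :
    coeff μ (basisVec μ c) d = if d = c then 1 else 0 := by
  have h := (Real.sqrt_pos.2 (hμ d)).ne'
  by_cases hd : d = c
  · subst hd
    simp [coeff, basisVec, h]
  · simp [coeff, basisVec, hd]

/-- The inner product of `L²(ι, μ)` is `⟨f, g⟩ = ∑ c, f c * g c * μ c`. -/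
theorem hasSum_inner (μ : ι → ℝ) (hμ : ∀ c, 0 < μ c) (x y : WeightedL2 μ) :
    HasSum (fun c => coeff μ x c * coeff μ y c * μ c) (inner ℝ x y) := by
  have e : (fun c => coeff μ x c * coeff μ y c * μ c) =
      fun c => inner ℝ ((x : ∀ _ : ι, ℝ) c) ((y : ∀ _ : ι, ℝ) c) := by
    funext c
    have h := Real.sq_sqrt (hμ c).le
    have h' := (Real.sqrt_pos.2 (hμ c)).ne'
    simp only [coeff, RCLike.inner_apply, conj_trivial]
    nth_rewrite 3 [← h]
    field_simp
  rw [e]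
  exact lp.hasSum_inner (𝕜 := ℝ) x y

/-- Every function `f` with `∑ c, f c ^ 2 * μ c < ∞` belongs to `L²(ι, μ)`. -/
theorem exists_coeff_eq (μ : ι → ℝ) (hμ : ∀ c, 0 < μ c) (f : ι → ℝ)
    (hf : Summable fun c => f c ^ 2 * μ c) : ∃ x : WeightedL2 μ, coeff μ x = f := by
  refine ⟨⟨fun c => f c * √(μ c), memℓp_gen (hf.congr fun c => ?_)⟩, funext fun c => ?_⟩
  · have h := Real.sq_sqrt (hμ c).le
    simp [mul_pow, h]
  · exact mul_div_cancel_right₀ _ (Real.sqrt_pos.2 (hμ c)).ne'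

end WeightedL2

end WeightedL2

/-! ### Singular chains and cellular incidence numbers -/

section Cellular

/-- Singular `n`-chains of `X` with integer coefficients. -/
abbrev SingChain (X : Type*) [TopologicalSpace X] (n : ℕ) : Type _ :=
  C(stdSimplex ℝ (Fin (n + 1)), X) →₀ ℤ

/-- The `k`-th face of a singular simplex. -/
noncomputable def singFace {X : Type*} [TopologicalSpace X] {n : ℕ} (k : Fin (n + 2))
    (τ : C(stdSimplex ℝ (Fin (n + 2)), X)) : C(stdSimplex ℝ (Fin (n + 1)), X) :=
  τ.comp ⟨stdSimplex.map k.succAbove, stdSimplex.continuous_map _⟩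

/-- The singular boundary operator. -/
noncomputable def singBoundary {X : Type*} [TopologicalSpace X] {n : ℕ}
    (x : SingChain X (n + 1)) : SingChain X n :=
  x.sum fun τ a => ∑ k : Fin (n + 2), Finsupp.single (singFace k τ) ((-1) ^ (k : ℕ) * a)

/-- The singular chain `x` lies in the subspace `A`. -/
def SingChain.SupportedIn {X : Type*} [TopologicalSpace X] {n : ℕ} (x : SingChain X n)
    (A : Set X) : Prop :=
  ∀ τ ∈ x.support, Set.range τ ⊆ A

variable {X : Type*} [TopologicalSpace X] [T2Space X] (Z : Set X) [CWComplex Z]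

/-- An orientation of the cells of `Z`: for each `n`-cell a parametrization of the closed `n`-disk
(which for Mathlib is the unit ball of the maximum norm) by the standard `n`-simplex.  Its
orientation class is the orientation of the cell. -/
abbrev CellOrientation : Type _ :=
  ∀ n : ℕ, RelCWComplex.cell Z n →
    (stdSimplex ℝ (Fin (n + 1)) ≃ₜ Metric.closedBall (0 : Fin n → ℝ) 1)

variable {Z}

/-- The oriented closed cell `c` as a singular simplex: the characteristic map of `c` composed with
the orienting parametrization of the disk. -/
noncomputable def cellSimplex (o : CellOrientation Z) {n : ℕ} (c : RelCWComplex.cell Z n) :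
    C(stdSimplex ℝ (Fin (n + 1)), X) where
  toFun p := RelCWComplex.map n c (o n c p : Fin n → ℝ)
  continuous_toFun :=
    (RelCWComplex.continuousOn n c).comp_continuous
      (continuous_subtype_val.comp (o n c).continuous) fun p => (o n c p).2

/-- `inc n β γ` is the incidence number `[β : γ]` of the oriented `n`-cell `β` in the boundary of
the oriented `(n+1)`-cell `γ`.

In homological terms: `∂[γ] = ∑ β, [β : γ] • [β]` in `H_n(Z^n, Z^(n-1); ℤ)`, where `[γ]` in
`H_(n+1)(Z^(n+1), Z^n)` and `[β]` are the classes of the oriented cells.  This is said with chains: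
each oriented `n`-cell `c` is represented by a singular chain `s c`, equal to the cell itself up to
a chain in the `(n-1)`-skeleton and carried by every subcomplex that contains `c`, and
`∂ (s γ) = ∑ β, [β : γ] • s β`.  Modulo chains of `Z^(n-1)` and boundaries of chains of `Z^n` this is
the homological formula, so `inc` is determined by the orientation.  Conversely, the incidence
numbers always arise so: given `s` in dimensions `≤ n`, the cycles `∂ γ` and `∑ β, [β : γ] • s β` of
`Z^n` have the same class in `H_n(Z^n, Z^(n-1))`, hence in `H_n(Z^n)` because `H_n(Z^(n-1)) = 0`, so
that they differ by the boundary of a chain of `Z^n`, by which one corrects `γ` to `s γ`.  (One does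
this inside the smallest subcomplex that contains `γ`.) -/
def IsCellularIncidence (o : CellOrientation Z)
    (inc : ∀ n : ℕ, RelCWComplex.cell Z n → RelCWComplex.cell Z (n + 1) → ℤ) : Prop :=
  ∃ s : ∀ n : ℕ, RelCWComplex.cell Z n → SingChain X n,
    (∀ n c, (s n c - Finsupp.single (cellSimplex o c) 1).SupportedIn
      (RelCWComplex.skeletonLT Z n : Set X)) ∧
    (∀ n c, ∀ K : RelCWComplex.Subcomplex Z, RelCWComplex.openCell n c ⊆ (K : Set X) →
      (s n c).SupportedIn (K : Set X)) ∧
    ∀ n γ, singBoundary (s (n + 1) γ) = ∑ᶠ β, inc n β γ • s n β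

end Cellular

/-! ### Coxeter systems, multiparameters and Hecke algebras -/

namespace CoxeterSystem

variable {B W : Type*} [Group W] {M : CoxeterMatrix B} (cs : CoxeterSystem M W)

/-- The special subgroup `W_T` generated by `T ⊆ S`. -/
def special (T : Set B) : Subgroup W := Subgroup.closure (cs.simple '' T)

/-- `q_w = q_{s₁} ⋯ q_{s_l}` for a reduced expression `w = s₁ ⋯ s_l`.  It does not depend on the
expression if `q` takes equal values at conjugate generators. -/
noncomputable def wordWeight (q : B → ℝ) (w : W) : ℝ :=
  ((cs.exists_isReduced w).choose.map q).prod

/-- The growth series `W_T(q) = ∑_{w ∈ W_T} q_w` of a finite special subgroup. -/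
noncomputable def growth (q : B → ℝ) (T : Set B) : ℝ :=
  ∑ᶠ w : cs.special T, cs.wordWeight q (w : W)

/-- The shortest element of a coset `w W_T`. -/
noncomputable def shortest {T : Set B} (x : W ⧸ cs.special T) : W :=
  Function.argminOn cs.length {w : W | (w : W ⧸ cs.special T) = x}
    (QuotientGroup.mk_surjective x)

open Classical in
/-- Left multiplication by the generator `e_s` of the Hecke algebra `ℝ_q[W]`, on functions
`f = ∑ w, f w • e_w` on `W`; see `heckeLeft_single` for its values on the basis `e_w`. -/
noncomputable def heckeLeft (q : B → ℝ) (s : B) (f : W → ℝ) (w : W) : ℝ :=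
  if cs.length (cs.simple s * w) < cs.length w then f (cs.simple s * w) + (q s - 1) * f w
  else q s * f (cs.simple s * w)

/-- The defining relations of the Hecke algebra: `e_s e_w = e_{sw}` if `l(sw) > l(w)`, and
`e_s e_w = q_s e_{sw} + (q_s - 1) e_w` if `l(sw) < l(w)`. -/
theorem heckeLeft_single [DecidableEq W] (q : B → ℝ) (s : B) (w : W) :
    cs.heckeLeft q s (Pi.single w 1) =
      if cs.length w < cs.length (cs.simple s * w) then Pi.single (cs.simple s * w) 1
      else q s • Pi.single (cs.simple s * w) 1 + (q s - 1) • Pi.single w 1 := by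
  have hss : ∀ v, cs.simple s * (cs.simple s * v) = v := fun v => by simp
  have hne := cs.length_simple_mul_ne w s
  funext v
  by_cases h1 : v = cs.simple s * w
  · subst h1
    have h2 : cs.simple s * w ≠ w := fun h => hne (congrArg cs.length h)
    by_cases h : cs.length w < cs.length (cs.simple s * w)
    · simp [heckeLeft, h, Pi.single_eq_of_ne h2]
    · simp [heckeLeft, h, Pi.single_eq_of_ne h2]
  · have h2 : cs.simple s * v ≠ w := fun h => h1 (by rw [← h, hss])
    by_cases h3 : v = w
    · subst h3
      by_cases h : cs.length v < cs.length (cs.simple s * v)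
      · simp [heckeLeft, h, not_lt.2 h.le, h2, h1]
      · have h' : cs.length (cs.simple s * v) < cs.length v :=
          lt_of_le_of_ne (not_lt.1 h) hne
        simp [heckeLeft, h, h', h2, h1]
    · by_cases h : cs.length w < cs.length (cs.simple s * w) <;>
        simp [heckeLeft, h, h1, h2, h3]

/-- The weight on `J × W` for which `L²(J × W) = ⨁_{j ∈ J} L²_q(W)`, the orthogonal direct sum of
copies of `L²_q(W)`; here `L²_q(W)` has `⟨e_v, e_w⟩ = q_w` if `v = w`, and `0` otherwise. -/
noncomputable def sumWeight (q : B → ℝ) (J : Type*) (p : J × W) : ℝ := cs.wordWeight q p.2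

/-- A Hilbert `N_q`-module: a closed subspace of a finite orthogonal direct sum
`⨁_{j ∈ J} L²_q(W)` that is stable under the diagonal left action of the Hecke algebra (it suffices
to consider the generators `e_s`). -/
def IsHilbertModule (q : B → ℝ) {J : Type*}
    (V : Submodule ℝ (WeightedL2 (cs.sumWeight q J))) : Prop :=
  IsClosed (V : Set (WeightedL2 (cs.sumWeight q J))) ∧
  ∀ s : B, ∀ x ∈ V, ∃ y ∈ V, ∀ (j : J) (w : W),
    WeightedL2.coeff (cs.sumWeight q J) y (j, w) =
      cs.heckeLeft q s (fun v => WeightedL2.coeff (cs.sumWeight q J) x (j, v)) w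

/-- The von Neumann trace of an endomorphism `Φ` of `⨁_{j ∈ J} L²_q(W)` commuting with the left
action of the Hecke algebra: the sum over `j` of `⟨e_1 φ_jj, e_1⟩_q`, where `φ_jj` in `N_q` is the
`j`-th diagonal entry of the matrix of `Φ`. -/
noncomputable def vnTrace (q : B → ℝ) {J : Type*}
    (Φ : WeightedL2 (cs.sumWeight q J) →L[ℝ] WeightedL2 (cs.sumWeight q J)) : ℝ :=
  ∑ᶠ j : J, inner ℝ (Φ (WeightedL2.basisVec (cs.sumWeight q J) (j, 1)))
    (WeightedL2.basisVec (cs.sumWeight q J) (j, 1))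

/-- The von Neumann dimension: the trace of the orthogonal projection onto (the closure of) `V`. -/
noncomputable def vnDim (q : B → ℝ) {J : Type*}
    (V : Submodule ℝ (WeightedL2 (cs.sumWeight q J))) : ℝ :=
  cs.vnTrace q V.topologicalClosure.starProjection

end CoxeterSystem

/-! ### The complex `U(W, Z)` and its weighted `L²`-cohomology -/

namespace BasicConstruction

variable {B W : Type*} [Group W] {M : CoxeterMatrix B} (cs : CoxeterSystem M W)
  {X : Type*} [TopologicalSpace X] {Z : Set X} [CWComplex Z]
  (mirror : B → RelCWComplex.Subcomplex Z)

/-- The family of mirrors is `W`-finite: `Z_T = Z ∩ ⋂_{s ∈ T} Z_s` is empty whenever `W_T` is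
infinite. -/
def WFinite : Prop :=
  ∀ T : Set B, Infinite (cs.special T) → Z ∩ ⋂ s ∈ T, (mirror s : Set X) = ∅

/-- `S(c)`, the set of those `s` for which the cell `c` lies in the mirror `Z_s`. -/
def cellType {n : ℕ} (c : RelCWComplex.cell Z n) : Set B :=
  {s | RelCWComplex.openCell n c ⊆ (mirror s : Set X)}

/-- The set of `n`-cells of `U(W, Z) = (W × Z)/∼`.  These are the translates `w c` of the `n`-cells
`c` of `Z`, and `w c = w' c'` if and only if `c = c'` and `w W_{S(c)} = w' W_{S(c)}`. -/
abbrev Cell (n : ℕ) : Type _ :=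
  Σ c : RelCWComplex.cell Z n, W ⧸ cs.special (cellType mirror c)

/-- The translate `w c` of a cell `c` of `Z`. -/
def translate {n : ℕ} (w : W) (c : RelCWComplex.cell Z n) : Cell cs mirror n :=
  ⟨c, (w : W ⧸ cs.special (cellType mirror c))⟩

/-- The weight `μ_q(w c) = q_u`, where `u` is the shortest element of `w W_{S(c)}`. -/
noncomputable def cellWeight (q : B → ℝ) (n : ℕ) (σ : Cell cs mirror n) : ℝ :=
  cs.wordWeight q (cs.shortest σ.2)

variable (inc : ∀ n : ℕ, RelCWComplex.cell Z n → RelCWComplex.cell Z (n + 1) → ℤ)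

/-- The coboundary `(δ f)(γ) = ∑ β, [β : γ] f(β)` of a cellular cochain of `U(W, Z)`, where `w c`
carries the orientation translated from `c`.  Write `γ = w c'` with a cell `c'` of `Z`.  The boundary
of `w c'` lies in `w Z`, so the cells `β` incident to `γ` are the `w c` for the cells `c` of `Z`
incident to `c'`, and `[w c : w c'] = [c : c']`. -/
noncomputable def coboundary {n : ℕ} (f : Cell cs mirror n → ℝ) (γ : Cell cs mirror (n + 1)) : ℝ :=
  ∑ᶠ c : RelCWComplex.cell Z n, (inc n c γ.1 : ℝ) * f (translate cs mirror (cs.shortest γ.2) c)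

/-- `L²_q C^n(U) = L²(U^(n), μ_q)`, the Hilbert space of weighted `L²`-cochains. -/
abbrev Cochain (q : B → ℝ) (n : ℕ) : Type _ := WeightedL2 (cellWeight cs mirror q n)

/-- The function on the `n`-cells of `U` underlying a weighted `L²`-cochain. -/
noncomputable abbrev value (q : B → ℝ) {n : ℕ} (x : Cochain cs mirror q n) :
    Cell cs mirror n → ℝ :=
  WeightedL2.coeff (cellWeight cs mirror q n) x

theorem coboundary_add [CWComplex.Finite Z] {n : ℕ} (f g : Cell cs mirror n → ℝ) :
    coboundary cs mirror inc (fun β => f β + g β) =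
      fun γ => coboundary cs mirror inc f γ + coboundary cs mirror inc g γ := by
  have : Finite (RelCWComplex.cell Z n) := CWComplex.FiniteType.finite_cell n
  funext γ
  simp only [coboundary, mul_add]
  exact finsum_add_distrib (Set.toFinite _) (Set.toFinite _)

theorem coboundary_smul [CWComplex.Finite Z] {n : ℕ} (a : ℝ) (f : Cell cs mirror n → ℝ) :
    coboundary cs mirror inc (fun β => a * f β) =
      fun γ => a * coboundary cs mirror inc f γ := by
  have : Finite (RelCWComplex.cell Z n) := CWComplex.FiniteType.finite_cell n
  funext γ
  simp only [coboundary, mul_finsum' _ _ (Set.toFinite _)]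
  exact finsum_congr fun c => by ring

theorem coboundary_zero {n : ℕ} :
    coboundary cs mirror inc (fun _ : Cell cs mirror n => (0 : ℝ)) = fun _ => 0 := by
  funext γ
  simp [coboundary]

/-- `Ker δ^n`, the space of weighted `L²`-cocycles. -/
noncomputable def cocycles [CWComplex.Finite Z] (q : B → ℝ) (n : ℕ) :
    Submodule ℝ (Cochain cs mirror q n) where
  carrier := {x | coboundary cs mirror inc (value cs mirror q x) = fun _ => 0}
  add_mem' {x y} hx hy := by
    have h : value cs mirror q (x + y) = fun β => value cs mirror q x β + value cs mirror q y β :=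
      funext fun β => WeightedL2.coeff_add _ x y β
    simp only [Set.mem_ofPred_eq] at hx hy ⊢
    rw [h, coboundary_add, hx, hy]
    simp
  zero_mem' := by
    have h : value cs mirror q (0 : Cochain cs mirror q n) = fun _ => 0 :=
      funext fun β => WeightedL2.coeff_zero _ β
    simp only [Set.mem_ofPred_eq]
    rw [h, coboundary_zero]
  smul_mem' a x hx := by
    have h : value cs mirror q (a • x) = fun β => a * value cs mirror q x β :=
      funext fun β => WeightedL2.coeff_smul _ a x β
    simp only [Set.mem_ofPred_eq] at hx ⊢
    rw [h, coboundary_smul, hx]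
    simp

/-- `Im δ^(n-1)`, the space of coboundaries of weighted `L²`-cochains; it is zero for `n = 0`. -/
noncomputable def coboundaries [CWComplex.Finite Z] (q : B → ℝ) :
    ∀ n : ℕ, Submodule ℝ (Cochain cs mirror q n)
  | 0 => ⊥
  | n + 1 =>
    { carrier := {x | ∃ y : Cochain cs mirror q n,
        value cs mirror q x = coboundary cs mirror inc (value cs mirror q y)}
      add_mem' := by
        rintro x x' ⟨y, hy⟩ ⟨y', hy'⟩
        refine ⟨y + y', ?_⟩
        have h : value cs mirror q (y + y') =
            fun β => value cs mirror q y β + value cs mirror q y' β :=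
          funext fun β => WeightedL2.coeff_add _ y y' β
        rw [h, coboundary_add, ← hy, ← hy']
        exact funext fun β => WeightedL2.coeff_add _ x x' β
      zero_mem' := by
        refine ⟨0, ?_⟩
        have h : value cs mirror q (0 : Cochain cs mirror q n) = fun _ => 0 :=
          funext fun β => WeightedL2.coeff_zero _ β
        rw [h, coboundary_zero]
        exact funext fun β => WeightedL2.coeff_zero _ β
      smul_mem' := by
        rintro a x ⟨y, hy⟩
        refine ⟨a • y, ?_⟩
        have h : value cs mirror q (a • y) = fun β => a * value cs mirror q y β :=
          funext fun β => WeightedL2.coeff_smul _ a y β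
        rw [h, coboundary_smul, ← hy]
        exact funext fun β => WeightedL2.coeff_smul _ a x β }

/-- The reduced weighted `L²`-cohomology `Ker δ^n / closure (Im δ^(n-1))`, as the Hilbert space of
harmonic cochains: the orthogonal complement of `Im δ^(n-1)` in `Ker δ^n`.  (The adjoint of
`δ^(n-1)` is `∂^q`, so this is `Ker δ^n ∩ Ker ∂^q_n`.) -/
noncomputable def reducedCohomology [CWComplex.Finite Z] (q : B → ℝ) (n : ℕ) :
    Submodule ℝ (Cochain cs mirror q n) :=
  cocycles cs mirror inc q n ⊓ (coboundaries cs mirror inc q n)ᗮ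

/-- The image of a space `V` of cochains under the isometric embedding
`Φ : L²_q C^n(U) → ⨁_{c ∈ Z^(n)} L²_q(W)`, whose `c`-component is
`√(W_{S(c)}(q)) ∑_u f(u c) e_u a_{S(c)}`, where `u` runs over the shortest elements of the cosets of
`W_{S(c)}` and `a_T = W_T(q)⁻¹ ∑_{v ∈ W_T} e_v`.  Since `e_u e_v = e_{uv}` here, the coefficient of
this component at `e_w` is `f(w c) / √(W_{S(c)}(q))`. -/
noncomputable def embed (q : B → ℝ) {n : ℕ} (V : Submodule ℝ (Cochain cs mirror q n)) :
    Submodule ℝ (WeightedL2 (cs.sumWeight q (RelCWComplex.cell Z n))) where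
  carrier := {y | ∃ x ∈ V, ∀ (c : RelCWComplex.cell Z n) (w : W),
    WeightedL2.coeff (cs.sumWeight q (RelCWComplex.cell Z n)) y (c, w) =
      value cs mirror q x (translate cs mirror w c) / √(cs.growth q (cellType mirror c))}
  add_mem' := by
    rintro y y' ⟨x, hx, h⟩ ⟨x', hx', h'⟩
    refine ⟨x + x', V.add_mem hx hx', fun c w => ?_⟩
    rw [WeightedL2.coeff_add, h, h', ← add_div]
    exact congrArg (· / _) (WeightedL2.coeff_add _ x x' _).symm
  zero_mem' := ⟨0, V.zero_mem, fun c w => by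
    rw [WeightedL2.coeff_zero, value, WeightedL2.coeff_zero, zero_div]⟩
  smul_mem' := by
    rintro a y ⟨x, hx, h⟩
    refine ⟨a • x, V.smul_mem a hx, fun c w => ?_⟩
    rw [WeightedL2.coeff_smul, h, ← mul_div_assoc]
    exact congrArg (· / _) (WeightedL2.coeff_smul _ a x _).symm

/-- The `n`-th `L²_q`-Betti number `b^n_q(U)`, the von Neumann dimension of the reduced weighted
`L²`-cohomology. -/
noncomputable def betti [CWComplex.Finite Z] (q : B → ℝ) (n : ℕ) : ℝ :=
  cs.vnDim q (embed cs mirror q (reducedCohomology cs mirror inc q n))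

end BasicConstruction

/-! The proof expresses the Betti number through functions that are monotone in $\mathbf q$ and
whose weighted sum is known to be continuous. For a space $V$ of cochains, let $p_V$ be the
projection onto its closure. Since $\Phi$ is isometric and its adjoint sends $e_1^c$ to
$e_{1c}/\sqrt{W_{S(c)}(\mathbf q)}$, the dimension of $\Phi(V)$ is $\sum_c \|p_V
e_{1c}\|^2/W_{S(c)}(\mathbf q)$ (`vnDim_embed`). Coboundaries are cocycles, so the Betti number is
the same sum for the cocycles minus that for the coboundaries (`betti_eq_sum`). The growth
polynomials are continuous and positive, so it suffices that the numbers $\|p_V e_{1c}\|^2$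
(`localDim`) are continuous for both spaces.

Monotonicity: $\mu_{\mathbf q}(1c)=1$ for every $\mathbf q$, so $\|p_V e_{1c}\|$ is the norm of the
evaluation $f\mapsto f(1c)$ on the closure of $V$. Let $\mathbf q\le\mathbf q'$. The inclusion
$L^2_{\mathbf q'}\subseteq L^2_{\mathbf q}$ is a contraction that preserves cocycles. Multiplication
by $\mu_{\mathbf q}/\mu_{\mathbf q'}$ is a contraction the other way that preserves orthogonality to
coboundaries. Both preserve the value at $1c$, so both local dimensions decrease as $\mathbf q$
grows (`localDim_cocycles_antitone`, `localDim_coboundaries_antitone`).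

Rank formula: the von Neumann trace satisfies
$\operatorname{tr}(\varphi\psi)=\operatorname{tr}(\psi\varphi)$, so the coimage and the closed image
of $\delta^n$ have equal dimension (`sum_one_sub_localDim_cocycles`). Hence the local dimensions of
the $n$-cocycles and the $(n+1)$-coboundaries, weighted by $1/W_{S(c)}(\mathbf q)$, add up to
$\sum_{c\in Z^{(n)}}1/W_{S(c)}(\mathbf q)$, which is continuous. Jumps of antitone functions all
have the same sign and cannot cancel, so every term is continuous
(`continuousOn_of_antitone_of_sum`).

The module property holds because the $e_s$ are self-adjoint, preserve functions constant on cosets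
(`heckeLeft_mul_of_mem`), and commute with the coboundary, which $\Phi$ turns into a matrix of real
scalars. The facts needed about lengths and weights come from inversion sets, constructed by an
action of $W$ on $W\times\{\pm1\}$. -/

theorem Function.End.mul_apply {α : Type*} (f g : Function.End α) (x : α) :
    (f * g) x = f (g x) := rfl

theorem Function.End.one_apply {α : Type*} (x : α) : (1 : Function.End α) x = x := rfl

/-! ### Inversion sets in a Coxeter group -/

namespace CoxeterSystem

variable {B W : Type*} [Group W] {M : CoxeterMatrix B} (cs : CoxeterSystem M W)

open Classical in
/-- The action of a simple reflection on `W × {±1}`: conjugation on the first factor, with a sign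
change exactly at the reflection itself. -/
noncomputable def signedConj (i : B) : Function.End (W × ZMod 2) :=
  fun p => (cs.simple i * p.1 * cs.simple i, p.2 + if p.1 = cs.simple i then 1 else 0)

-- The reflections that flip the sign are the entries of the inversion sequence of an alternating
-- word of length $2m$, namely $(s_js_i)^ks_j$ for $k<2m$.
open Classical in
theorem signedConj_mul_pow_apply (i j : B) (m : ℕ) (t : W) (ε : ZMod 2) :
    ((cs.signedConj i * cs.signedConj j) ^ m) (t, ε) =
      ((cs.simple i * cs.simple j) ^ m * t * ((cs.simple i * cs.simple j) ^ m)⁻¹,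
        ε + ∑ k ∈ Finset.range (2 * m),
          if t = ((cs.simple i * cs.simple j)⁻¹) ^ k * cs.simple j then 1 else 0) := by
  induction m with
  | zero => simp [Function.End.one_apply]
  | succ m ih =>
    set x := cs.simple i * cs.simple j with hx
    have hxi : x⁻¹ = cs.simple j * cs.simple i := by simp [hx]
    have hjx : ∀ k : ℕ, cs.simple j * x ^ k = (x⁻¹) ^ k * cs.simple j := by
      intro k
      have h : SemiconjBy (cs.simple j) x x⁻¹ := by
        simp [SemiconjBy, hx, mul_assoc]
      exact (h.pow_right k).eq
    rw [pow_succ', Function.End.mul_apply, ih]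
    simp only [Function.End.mul_apply, signedConj, Prod.mk.injEq]
    constructor
    · rw [pow_succ' x, mul_inv_rev, hxi]
      simp only [mul_assoc, hx]
    · have e1 : (x ^ m * t * (x ^ m)⁻¹ = cs.simple j) ↔ t = (x⁻¹) ^ (2 * m) * cs.simple j := by
        rw [mul_inv_eq_iff_eq_mul, hjx, two_mul, pow_add, mul_assoc]
        rw [← eq_inv_mul_iff_mul_eq, inv_pow]
      have e2 : (cs.simple j * (x ^ m * t * (x ^ m)⁻¹) * cs.simple j = cs.simple i) ↔
          t = (x⁻¹) ^ (2 * m + 1) * cs.simple j := by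
        have : (cs.simple j * (x ^ m * t * (x ^ m)⁻¹) * cs.simple j = cs.simple i) ↔
            x ^ m * t * (x ^ m)⁻¹ = x⁻¹ * cs.simple j := by
          rw [hxi]
          constructor
          · intro h
            rw [← h]
            simp [mul_assoc]
          · intro h
            rw [h]
            simp [mul_assoc]
        rw [this, mul_inv_eq_iff_eq_mul, mul_assoc, hjx, ← eq_inv_mul_iff_mul_eq, ← inv_pow,
          show 2 * m + 1 = m + (1 + m) by ring, pow_add, pow_add, pow_one]
        simp only [mul_assoc]
      rw [show 2 * (m + 1) = 2 * m + 1 + 1 by ring, Finset.sum_range_succ, Finset.sum_range_succ]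
      simp only [e1, e2, add_assoc]

theorem isLiftable_signedConj : M.IsLiftable cs.signedConj := by
  classical
  intro i j
  funext ⟨t, ε⟩
  rw [signedConj_mul_pow_apply, cs.simple_mul_simple_pow, two_mul, Finset.sum_range_add]
  -- The $2m$ reflections repeat with period $m$, so each sign change occurs twice and cancels. An
  -- infinite order, encoded as $0$, gives the empty sum.
  have h : ∀ k, ((cs.simple i * cs.simple j)⁻¹) ^ (M i j + k) =
      ((cs.simple i * cs.simple j)⁻¹) ^ k := by
    intro k
    rw [pow_add, inv_pow, cs.simple_mul_simple_pow]
    simp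
  simp only [h, CharTwo.add_self_eq_zero]
  simp [Function.End.one_apply]

/-- The action of `W` on `W × {±1}` extending `signedConj`. -/
noncomputable def signedConjHom : W →* Function.End (W × ZMod 2) :=
  cs.lift ⟨cs.signedConj, cs.isLiftable_signedConj⟩

/-- The parity of the number of times that `t` occurs in the left inversion sequence of a word for
`w`. -/
noncomputable def invParity (w t : W) : ZMod 2 := (cs.signedConjHom w⁻¹ (t, 0)).2

theorem signedConjHom_apply (w t : W) (ε : ZMod 2) :
    cs.signedConjHom w (t, ε) = (w * t * w⁻¹, ε + cs.invParity w⁻¹ t) := by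
  -- Both claims are proved in one induction, because a sign change at the next letter depends on
  -- the first component.
  have h : ∀ (w t : W) (ε ε' : ZMod 2), (cs.signedConjHom w (t, ε)).1 = w * t * w⁻¹ ∧
      (cs.signedConjHom w (t, ε + ε')).2 = ε + (cs.signedConjHom w (t, ε')).2 := by
    intro w
    induction w using cs.simple_induction_left with
    | one => intro t ε ε'; simp [Function.End.one_apply]
    | mul_simple_left w i ih =>
      intro t ε ε'
      have hs : cs.signedConjHom (cs.simple i) = cs.signedConj i :=
        cs.lift_apply_simple cs.isLiftable_signedConj i
      rw [map_mul, hs]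
      simp only [Function.End.mul_apply, signedConj, (ih _ _ ε').2]
      rw [(ih t (ε + ε') 0).1, (ih t ε' 0).1, (ih t ε 0).1]
      refine ⟨by simp [mul_assoc], by ring⟩
  ext1
  · exact (h w t ε 0).1
  · have := (h w t ε 0).2
    simpa [invParity] using this

/-- Cocycle rule for left inversion sets: $N(uv)=N(u)\,\triangle\,uN(v)u^{-1}$. It is the
composition law of the action on signs. -/
theorem invParity_mul (u v t : W) :
    cs.invParity (u * v) t = cs.invParity u t + cs.invParity v (u⁻¹ * t * u) := by
  have h : cs.signedConjHom (u * v)⁻¹ (t, 0) =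
      cs.signedConjHom v⁻¹ (cs.signedConjHom u⁻¹ (t, 0)) := by
    rw [mul_inv_rev, map_mul]
    rfl
  have h2 := congrArg Prod.snd h
  rw [signedConjHom_apply, signedConjHom_apply, signedConjHom_apply] at h2
  simpa using h2

open Classical in
theorem invParity_simple (i : B) (t : W) :
    cs.invParity (cs.simple i) t = if t = cs.simple i then 1 else 0 := by
  have hs : cs.signedConjHom (cs.simple i) = cs.signedConj i :=
    cs.lift_apply_simple cs.isLiftable_signedConj i
  simp [invParity, hs, signedConj]

theorem invParity_one (t : W) : cs.invParity 1 t = 0 := by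
  simp [invParity, Function.End.one_apply]

-- The left side depends only on the product of the word, so the parity of each multiplicity is the
-- same for all words of an element. In a reduced word the multiplicities are $0$ or $1$, so the
-- inversion set itself is an invariant of the element.
open Classical in
theorem invParity_wordProd (ω : List B) (t : W) :
    cs.invParity (cs.wordProd ω) t = (List.count t (cs.leftInvSeq ω) : ZMod 2) := by
  induction ω generalizing t with
  | nil => simp [invParity_one]
  | cons i ω ih =>
    have hc : List.count t (List.map (MulAut.conj (cs.simple i)) (cs.leftInvSeq ω)) =
        List.count (cs.simple i * t * cs.simple i) (cs.leftInvSeq ω) := by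
      have : t = MulAut.conj (cs.simple i) (cs.simple i * t * cs.simple i) := by
        simp [mul_assoc]
      conv_lhs => rw [this]
      exact List.count_map_of_injective _ _ (MulAut.conj (cs.simple i)).injective _
    rw [cs.wordProd_cons, invParity_mul, invParity_simple, ih, leftInvSeq, List.count_cons, hc]
    push_cast
    rw [add_comm, inv_simple]
    simp only [beq_iff_eq, eq_comm (a := t)]

theorem IsReduced.mem_leftInvSeq_iff {cs : CoxeterSystem M W} {ω : List B} (hω : cs.IsReduced ω)
    (t : W) : t ∈ cs.leftInvSeq ω ↔ cs.invParity (cs.wordProd ω) t ≠ 0 := by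
  classical
  rw [invParity_wordProd, hω.nodup_leftInvSeq.count]
  split_ifs with h <;> simp [h]

theorem length_mul_lt_of_invParity_ne_zero {w t : W} (h : cs.invParity w t ≠ 0) :
    cs.length (t * w) < cs.length w := by
  obtain ⟨ω, hω, rfl⟩ := cs.exists_isReduced w
  exact (cs.isLeftInversion_of_mem_leftInvSeq hω ((hω.mem_leftInvSeq_iff t).2 h)).2

theorem IsReduced.cons {cs : CoxeterSystem M W} {ω : List B} (hω : cs.IsReduced ω) {i : B}
    (h : cs.length (cs.wordProd ω) < cs.length (cs.simple i * cs.wordProd ω)) :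
    cs.IsReduced (i :: ω) := by
  have := cs.length_simple_mul (cs.wordProd ω) i
  rw [IsReduced, cs.wordProd_cons, List.length_cons, ← hω.eq]
  omega

theorem invParity_simple_ne_zero_iff {w : W} {i : B} :
    cs.invParity w (cs.simple i) ≠ 0 ↔ cs.length (cs.simple i * w) < cs.length w := by
  refine ⟨cs.length_mul_lt_of_invParity_ne_zero, fun h => ?_⟩
  obtain ⟨ω, hω, hw⟩ := cs.exists_isReduced (cs.simple i * w)
  have hw' : w = cs.wordProd (i :: ω) := by
    rw [cs.wordProd_cons, ← hw]
    simp
  have hr : cs.IsReduced (i :: ω) := hω.cons (by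
    rw [← hw]
    simpa using h)
  rw [hw']
  exact (hr.mem_leftInvSeq_iff _).1 (by simp [leftInvSeq])

/-- By the cocycle rule, all inversions of a product of generators from $T$ are conjugates, inside
$W_T$, of such generators. -/
theorem mem_special_of_invParity_ne_zero {T : Set B} {v t : W} (hv : v ∈ cs.special T)
    (h : cs.invParity v t ≠ 0) : t ∈ cs.special T := by
  classical
  have key : ∀ v ∈ cs.special T, ∀ t, cs.invParity v t ≠ 0 → t ∈ cs.special T := by
    intro v hv
    induction hv using Subgroup.closure_induction with
    | mem x hx =>
      obtain ⟨i, hi, rfl⟩ := hx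
      intro t ht
      rw [invParity_simple] at ht
      have : t = cs.simple i := by
        by_contra hne
        simp [hne] at ht
      rw [this]
      exact Subgroup.subset_closure ⟨i, hi, rfl⟩
    | one =>
      intro t ht
      exact absurd (cs.invParity_one t) ht
    | mul x y hx hy ihx ihy =>
      intro t ht
      rw [invParity_mul] at ht
      by_cases h1 : cs.invParity x t = 0
      · rw [h1, zero_add] at ht
        have h2 := ihy _ ht
        have h3 := (cs.special T).mul_mem ((cs.special T).mul_mem hx h2) ((cs.special T).inv_mem hx)
        simpa [mul_assoc] using h3
      · exact ihx t h1
    | inv x hx ih =>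
      intro t ht
      -- The cocycle rule for $xx^{-1}=1$ turns an inversion $t$ of $x^{-1}$ into the inversion
      -- $xtx^{-1}$ of $x$.
      have h1 := cs.invParity_mul x x⁻¹ (x * t * x⁻¹)
      rw [mul_inv_cancel, invParity_one] at h1
      have h2 : x⁻¹ * (x * t * x⁻¹) * x = t := by group
      rw [h2] at h1
      have h3 : cs.invParity x (x * t * x⁻¹) ≠ 0 := by
        intro h0
        rw [h0, zero_add] at h1
        exact ht h1.symm
      have h4 := ih _ h3
      have h5 := (cs.special T).mul_mem ((cs.special T).mul_mem ((cs.special T).inv_mem hx) h4) hx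
      rwa [h2] at h5
  exact key v hv t h

/-- If `s` is a left descent of exactly one of two elements of a coset `w W_T`, then `s` maps this
coset to itself. -/
theorem mk_simple_mul_eq_of_descent_change {T : Set B} {w v : W} {i : B} (hv : v ∈ cs.special T)
    (h : ¬(cs.length (cs.simple i * w) < cs.length w ↔
      cs.length (cs.simple i * (w * v)) < cs.length (w * v))) :
    ((cs.simple i * w : W) : W ⧸ cs.special T) = (w : W ⧸ cs.special T) := by
  -- Descents are inversions at $s$. By the cocycle rule those of $w$ and $wv$ differ only if
  -- $w^{-1}sw$ is an inversion of $v$, and then $w^{-1}sw\in W_T$.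
  rw [← invParity_simple_ne_zero_iff, ← invParity_simple_ne_zero_iff, invParity_mul] at h
  have h1 : cs.invParity v (w⁻¹ * cs.simple i * w) ≠ 0 := by
    intro h0
    simp [h0] at h
  have h2 := cs.mem_special_of_invParity_ne_zero hv h1
  rw [eq_comm, QuotientGroup.eq]
  simpa [mul_assoc] using h2

/-! #### Weights -/

variable {cs} {q : B → ℝ}

open Classical in
/-- The extension of `q` to all elements of `W` that are conjugate to a generator. -/
noncomputable def conjWeight (cs : CoxeterSystem M W) (q : B → ℝ) (t : W) : ℝ :=
  if h : ∃ i, IsConj (cs.simple i) t then q h.choose else 1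

theorem conjWeight_simple (hc : ∀ i j, IsConj (cs.simple i) (cs.simple j) → q i = q j) (i : B) :
    cs.conjWeight q (cs.simple i) = q i := by
  have h : ∃ j, IsConj (cs.simple j) (cs.simple i) := ⟨i, IsConj.refl _⟩
  rw [conjWeight, dif_pos h]
  exact hc _ _ h.choose_spec

theorem conjWeight_conj (x t : W) : cs.conjWeight q (x * t * x⁻¹) = cs.conjWeight q t := by
  have h : ∀ i, IsConj (cs.simple i) (x * t * x⁻¹) ↔ IsConj (cs.simple i) t := by
    intro i
    have : IsConj t (x * t * x⁻¹) := isConj_iff.2 ⟨x, rfl⟩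
    exact ⟨fun h => h.trans this.symm, fun h => h.trans this⟩
  have h' : (fun i => IsConj (cs.simple i) (x * t * x⁻¹)) = fun i => IsConj (cs.simple i) t :=
    funext fun i => propext (h i)
  classical
  -- The chosen index depends only on the predicate, and conjugate elements define the same
  -- predicate.
  have key : ∀ P Q : B → Prop, P = Q → (if h : ∃ i, P i then q h.choose else 1) =
      if h : ∃ i, Q i then q h.choose else 1 := by
    rintro P _ rfl
    rfl
  simpa only [conjWeight] using key _ _ h'

/-- Each entry of the inversion sequence is a conjugate of the corresponding letter, so it has the
same weight. -/
theorem prod_map_conjWeight_leftInvSeq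
    (hc : ∀ i j, IsConj (cs.simple i) (cs.simple j) → q i = q j) (ω : List B) :
    ((cs.leftInvSeq ω).map (cs.conjWeight q)).prod = (ω.map q).prod := by
  induction ω with
  | nil => simp
  | cons i ω ih =>
    have : cs.conjWeight q ∘ (MulAut.conj (cs.simple i)) = cs.conjWeight q := by
      funext t
      simpa using conjWeight_conj (cs := cs) (q := q) (cs.simple i) t
    simp [leftInvSeq, this, ih, conjWeight_simple hc]

theorem IsReduced.prod_map_eq_finprod
    (hc : ∀ i j, IsConj (cs.simple i) (cs.simple j) → q i = q j) {ω : List B}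
    (hω : cs.IsReduced ω) :
    (ω.map q).prod = ∏ᶠ t ∈ {t | cs.invParity (cs.wordProd ω) t ≠ 0}, cs.conjWeight q t := by
  classical
  have h : {t | cs.invParity (cs.wordProd ω) t ≠ 0} = ((cs.leftInvSeq ω).toFinset : Set W) := by
    ext t
    simp [← hω.mem_leftInvSeq_iff]
  rw [← prod_map_conjWeight_leftInvSeq hc, h, finprod_mem_coe_finset,
    List.prod_toFinset _ hω.nodup_leftInvSeq]

/-- The weight becomes a product over the inversion set. This removes the chosen reduced word and
reduces multiplicativity to a disjoint union of sets. -/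
theorem wordWeight_eq_finprod
    (hc : ∀ i j, IsConj (cs.simple i) (cs.simple j) → q i = q j) (w : W) :
    cs.wordWeight q w = ∏ᶠ t ∈ {t | cs.invParity w t ≠ 0}, cs.conjWeight q t := by
  have h := (cs.exists_isReduced w).choose_spec
  have h2 := h.1.prod_map_eq_finprod hc
  rwa [← h.2] at h2

theorem finite_invParity_ne_zero (w : W) : {t | cs.invParity w t ≠ 0}.Finite := by
  obtain ⟨ω, hω, rfl⟩ := cs.exists_isReduced w
  refine (cs.leftInvSeq ω).finite_toSet.subset fun t ht => ?_
  exact (hω.mem_leftInvSeq_iff t).2 ht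

theorem IsReduced.wordWeight_wordProd
    (hc : ∀ i j, IsConj (cs.simple i) (cs.simple j) → q i = q j) {ω : List B}
    (hω : cs.IsReduced ω) : cs.wordWeight q (cs.wordProd ω) = (ω.map q).prod := by
  rw [wordWeight_eq_finprod hc, hω.prod_map_eq_finprod hc]

theorem wordWeight_pos (hq : ∀ i, 0 < q i) (w : W) : 0 < cs.wordWeight q w := by
  refine List.prod_pos fun a ha => ?_
  obtain ⟨i, -, rfl⟩ := List.mem_map.1 ha
  exact hq i

/-- The reduced word chosen in `wordWeight` does not depend on the parameters, so the two products
are compared factor by factor. -/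
theorem wordWeight_mono {q' : B → ℝ} (hq : ∀ i, 0 < q i) (h : ∀ i, q i ≤ q' i) (w : W) :
    cs.wordWeight q w ≤ cs.wordWeight q' w := by
  unfold wordWeight
  induction (cs.exists_isReduced w).choose with
  | nil => simp
  | cons i ω ih =>
    simp only [List.map_cons, List.prod_cons]
    refine mul_le_mul (h i) ih (List.prod_nonneg fun a ha => ?_) ((hq i).trans_le (h i)).le
    obtain ⟨i, -, rfl⟩ := List.mem_map.1 ha
    exact (hq i).le

@[simp]
theorem wordWeight_one (q : B → ℝ) : cs.wordWeight q 1 = 1 := by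
  have h := (cs.exists_isReduced (1 : W)).choose_spec
  have h1 : (cs.exists_isReduced (1 : W)).choose = [] := by
    have := h.1.eq
    rw [← h.2, cs.length_one] at this
    exact List.eq_nil_of_length_eq_zero this.symm
  rw [wordWeight, h1]
  simp

theorem wordWeight_simple_mul (hc : ∀ i j, IsConj (cs.simple i) (cs.simple j) → q i = q j)
    {w : W} {i : B} (h : cs.length w < cs.length (cs.simple i * w)) :
    cs.wordWeight q (cs.simple i * w) = q i * cs.wordWeight q w := by
  obtain ⟨ω, hω, rfl⟩ := cs.exists_isReduced w
  rw [← cs.wordProd_cons, (hω.cons h).wordWeight_wordProd hc, hω.wordWeight_wordProd hc]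
  simp

theorem wordWeight_inv (hc : ∀ i j, IsConj (cs.simple i) (cs.simple j) → q i = q j) (w : W) :
    cs.wordWeight q w⁻¹ = cs.wordWeight q w := by
  obtain ⟨ω, hω, rfl⟩ := cs.exists_isReduced w
  rw [← cs.wordProd_reverse, hω.reverse.wordWeight_wordProd hc, hω.wordWeight_wordProd hc,
    List.map_reverse, List.prod_reverse]

/-- For $u$ shortest in $uW_T$ the sets $N(u)$ and $uN(v)u^{-1}$ are disjoint: a common element
$utu^{-1}$, with $t\in W_T$, would make $ut$ shorter than $u$. Hence $N(uv)$ is their union. -/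
theorem wordWeight_mul (hc : ∀ i j, IsConj (cs.simple i) (cs.simple j) → q i = q j)
    {T : Set B} {u v : W} (hu : ∀ v ∈ cs.special T, cs.length u ≤ cs.length (u * v))
    (hv : v ∈ cs.special T) :
    cs.wordWeight q (u * v) = cs.wordWeight q u * cs.wordWeight q v := by
  have hdisj : Disjoint {t | cs.invParity u t ≠ 0}
      (MulAut.conj u '' {t | cs.invParity v t ≠ 0}) := by
    rw [Set.disjoint_left]
    rintro _ ht ⟨t, ht', rfl⟩
    have h1 := cs.length_mul_lt_of_invParity_ne_zero ht
    have h2 := hu t (cs.mem_special_of_invParity_ne_zero hv ht')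
    simp at h1
    omega
  have hunion : {t | cs.invParity (u * v) t ≠ 0} =
      {t | cs.invParity u t ≠ 0} ∪ MulAut.conj u '' {t | cs.invParity v t ≠ 0} := by
    have hmem : ∀ t, t ∈ MulAut.conj u '' {t | cs.invParity v t ≠ 0} ↔
        cs.invParity v (u⁻¹ * t * u) ≠ 0 := by
      intro t
      constructor
      · rintro ⟨t, ht, rfl⟩
        have : u⁻¹ * (MulAut.conj u t) * u = t := by simp [mul_assoc]
        rwa [this]
      · intro h
        exact ⟨_, h, by simp [mul_assoc]⟩
    ext t
    have h2 := fun h : t ∈ {t | cs.invParity u t ≠ 0} => Set.disjoint_left.1 hdisj h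
    simp only [Set.mem_union, hmem, Set.mem_ofPred_eq, invParity_mul] at h2 ⊢
    -- What remains is a statement about $a,b\in\mathbb Z/2$ that are not both nonzero.
    generalize cs.invParity u t = a at *
    generalize cs.invParity v (u⁻¹ * t * u) = b at *
    revert a b
    decide
  rw [wordWeight_eq_finprod hc, hunion, finprod_mem_union hdisj (finite_invParity_ne_zero u)
    ((finite_invParity_ne_zero v).image _), ← wordWeight_eq_finprod hc,
    finprod_mem_image (MulAut.conj u).injective.injOn, wordWeight_eq_finprod hc v]
  simp [conjWeight_conj]

theorem length_shortest_le {T : Set B} (x : W ⧸ cs.special T) {w : W}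
    (hw : (w : W ⧸ cs.special T) = x) : cs.length (cs.shortest x) ≤ cs.length w :=
  Function.argminOn_le cs.length _ hw

theorem mk_shortest {T : Set B} (x : W ⧸ cs.special T) :
    ((cs.shortest x : W) : W ⧸ cs.special T) = x :=
  Function.argminOn_mem cs.length {w : W | (w : W ⧸ cs.special T) = x}
    (QuotientGroup.mk_surjective x)

theorem wordWeight_shortest_mul (hc : ∀ i j, IsConj (cs.simple i) (cs.simple j) → q i = q j)
    {T : Set B} (x : W ⧸ cs.special T) {v : W} (hv : v ∈ cs.special T) :
    cs.wordWeight q (cs.shortest x * v) = cs.wordWeight q (cs.shortest x) * cs.wordWeight q v := by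
  refine wordWeight_mul hc (fun v hv => length_shortest_le x ?_) hv
  rw [QuotientGroup.mk_mul_of_mem _ hv, mk_shortest]

theorem shortest_mk_one (T : Set B) : cs.shortest ((1 : W) : W ⧸ cs.special T) = 1 := by
  have h := length_shortest_le (cs := cs) ((1 : W) : W ⧸ cs.special T) rfl
  rwa [cs.length_one, Nat.le_zero, cs.length_eq_zero_iff] at h

theorem one_le_growth (hq : ∀ i, 0 < q i) (T : Set B) [Finite (cs.special T)] :
    1 ≤ cs.growth q T := by
  have := Fintype.ofFinite (cs.special T)
  rw [growth, finsum_eq_sum_of_fintype]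
  have h := Finset.single_le_sum (f := fun w : cs.special T => cs.wordWeight q (w : W))
    (fun w _ => (wordWeight_pos hq _).le) (Finset.mem_univ 1)
  simpa using h

theorem continuous_growth {A : Type*} [TopologicalSpace A] {f : A → B → ℝ}
    (hf : ∀ i, Continuous fun a => f a i) (T : Set B) [Finite (cs.special T)] :
    Continuous fun a => cs.growth (f a) T := by
  have := Fintype.ofFinite (cs.special T)
  simp only [growth, finsum_eq_sum_of_fintype, wordWeight]
  refine continuous_finsetSum _ fun w _ => continuous_list_prod _ fun i _ => hf i

end CoxeterSystem

/-! ### Incidence numbers -/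

section Incidence

/-- The simplicial identity in a form without case distinction; it pairs the double faces that
cancel in the square of the boundary. -/
theorem singFace_singFace {X : Type*} [TopologicalSpace X] {n : ℕ} (k : Fin (n + 3))
    (l : Fin (n + 2)) (τ : C(stdSimplex ℝ (Fin (n + 3)), X)) :
    singFace (l.predAbove k) (singFace (k.succAbove l) τ) = singFace l (singFace k τ) := by
  ext p
  simp only [singFace, ContinuousMap.comp_apply, ContinuousMap.coe_mk]
  congr 1
  rw [stdSimplex.map_comp_apply, stdSimplex.map_comp_apply]
  congr 1
  funext m
  exact Fin.succAbove_succAbove_succAbove_predAbove k l m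

/-- The singular boundary operator as a homomorphism. -/
noncomputable def singBoundaryHom (X : Type*) [TopologicalSpace X] (n : ℕ) :
    SingChain X (n + 1) →+ SingChain X n :=
  Finsupp.liftAddHom fun τ => ∑ k : Fin (n + 2),
    (Finsupp.singleAddHom (singFace k τ)).comp (AddMonoidHom.mulLeft ((-1) ^ (k : ℕ)))

variable {X : Type*} [TopologicalSpace X]

theorem singBoundaryHom_apply {n : ℕ} (x : SingChain X (n + 1)) :
    singBoundaryHom X n x = singBoundary x := by
  rw [singBoundaryHom, singBoundary, Finsupp.liftAddHom_apply]
  refine Finsupp.sum_congr fun τ _ => ?_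
  rw [AddMonoidHom.finsetSum_apply]
  rfl

theorem singBoundaryHom_single {n : ℕ} (τ : C(stdSimplex ℝ (Fin (n + 2)), X)) (a : ℤ) :
    singBoundaryHom X n (Finsupp.single τ a) =
      ∑ k : Fin (n + 2), Finsupp.single (singFace k τ) ((-1) ^ (k : ℕ) * a) := by
  rw [singBoundaryHom, Finsupp.liftAddHom_apply_single, AddMonoidHom.finsetSum_apply]
  rfl

theorem singBoundary_singBoundary {n : ℕ} (x : SingChain X (n + 2)) :
    singBoundary (singBoundary x) = 0 := by
  rw [← singBoundaryHom_apply, ← singBoundaryHom_apply]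
  induction x using Finsupp.induction_linear with
  | zero => simp
  | add x y hx hy => rw [map_add, map_add, hx, hy, add_zero]
  | single τ a =>
    rw [singBoundaryHom_single, map_sum]
    simp only [singBoundaryHom_single]
    rw [← Fintype.sum_sigma' (fun (k : Fin (n + 3)) (l : Fin (n + 2)) =>
      Finsupp.single (singFace l (singFace k τ)) ((-1 : ℤ) ^ (l : ℕ) * ((-1) ^ (k : ℕ) * a)))]
    have hsign : ∀ (k : Fin (n + 3)) (l : Fin (n + 2)),
        (-1 : ℤ) ^ (l.predAbove k : ℕ) * (-1) ^ (k.succAbove l : ℕ) =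
          -((-1) ^ (l : ℕ) * (-1) ^ (k : ℕ)) := by
      intro k l
      rw [mul_comm, ← pow_add, Fin.neg_one_pow_succAbove_add_predAbove, pow_add, mul_comm]
    -- Double faces are paired by the involution of the simplicial identity; it changes the sign
    -- and, since it moves $k$, has no fixed points.
    refine Finset.sum_involution (fun p _ => ⟨p.1.succAbove p.2, p.2.predAbove p.1⟩) ?_ ?_ ?_ ?_
    · rintro ⟨k, l⟩ -
      simp only [singFace_singFace]
      rw [← Finsupp.single_add, ← mul_assoc, ← mul_assoc, hsign]
      simp
    · rintro ⟨k, l⟩ - - h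
      exact Fin.succAbove_ne k l (congrArg Sigma.fst h)
    · intro p _
      exact Finset.mem_univ _
    · rintro ⟨k, l⟩ -
      simp only [Fin.succAbove_succAbove_predAbove, Fin.predAbove_predAbove_succAbove]

theorem SingChain.SupportedIn.singBoundary {n : ℕ} {x : SingChain X (n + 1)} {A : Set X}
    (hx : x.SupportedIn A) : SingChain.SupportedIn (singBoundary x) A := by
  classical
  intro τ hτ
  have h1 := Finsupp.support_sum hτ
  obtain ⟨σ, hσ, h2⟩ := Finset.mem_biUnion.1 h1
  obtain ⟨k, -, h3⟩ := Finset.mem_biUnion.1 (Finsupp.support_finsetSum h2)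
  have h4 := Finsupp.support_single_subset h3
  rw [Finset.mem_singleton] at h4
  rintro _ ⟨p, rfl⟩
  rw [h4]
  exact hx σ hσ ⟨_, rfl⟩

variable {Z : Set X} [CWComplex Z]

theorem openCell_subset_of_mem_of_mem [T2Space X] {n : ℕ} {c : RelCWComplex.cell Z n}
    (K : RelCWComplex.Subcomplex Z) {x : X} (hx : x ∈ RelCWComplex.openCell n c)
    (hK : x ∈ (K : Set X)) : RelCWComplex.openCell n c ⊆ (K : Set X) := by
  by_contra h
  have h1 : c ∉ K.I n := fun hc => h (RelCWComplex.Subcomplex.openCell_subset_of_mem K hc)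
  exact Set.disjoint_left.1
    (RelCWComplex.Subcomplex.disjoint_openCell_subcomplex_of_not_mem K h1) hx hK

theorem exists_cellSimplex_mem_openCell (o : CellOrientation Z) {n : ℕ}
    (c : RelCWComplex.cell Z n) : ∃ p, cellSimplex o c p ∈ RelCWComplex.openCell n c := by
  refine ⟨(o n c).symm ⟨0, by simp⟩, ?_⟩
  refine ⟨0, by simp, ?_⟩
  simp [cellSimplex]

theorem cellSimplex_mem_closedCell (o : CellOrientation Z) {n : ℕ}
    (c : RelCWComplex.cell Z n) (p) : cellSimplex o c p ∈ RelCWComplex.closedCell n c :=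
  ⟨o n c p, (o n c p).2, rfl⟩

variable [T2Space X]

/-- The centre of a cell lies in its open cell, which meets neither the lower skeleton nor any other
open cell. -/
theorem cellSimplex_injective (o : CellOrientation Z) (n : ℕ) :
    Function.Injective (cellSimplex o : RelCWComplex.cell Z n → _) := by
  intro c c' h
  obtain ⟨p, hp⟩ := exists_cellSimplex_mem_openCell o c'
  have h1 := cellSimplex_mem_closedCell o c p
  rw [h, ← RelCWComplex.cellFrontier_union_openCell_eq_closedCell] at h1
  rcases h1 with h1 | h1
  · have h2 := RelCWComplex.cellFrontier_subset_skeletonLT n c h1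
    exact absurd hp (Set.disjoint_left.1
      (RelCWComplex.disjoint_skeletonLT_openCell (n := (n : ℕ∞)) le_rfl) h2)
  · have h2 := RelCWComplex.eq_of_not_disjoint_openCell
      (Set.not_disjoint_iff.2 ⟨_, h1, hp⟩)
    simpa using h2

section Coefficients

variable {o : CellOrientation Z} {n : ℕ} {s : RelCWComplex.cell Z n → SingChain X n}
-- The correction of $s(c)$ lies in the lower skeleton, which misses every open $n$-cell. So
-- coefficients at the cell simplices can be read off, and with them the incidence numbers.
open Classical in
theorem cellChain_apply_cellSimplex
    (hs : ∀ c, (s c - Finsupp.single (cellSimplex o c) 1).SupportedIn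
      (RelCWComplex.skeletonLT Z n : Set X))
    (c c' : RelCWComplex.cell Z n) :
    s c (cellSimplex o c') = if c = c' then 1 else 0 := by
  have h : (s c - Finsupp.single (cellSimplex o c) 1 : SingChain X n) (cellSimplex o c') = 0 := by
    by_contra h0
    have h1 := hs c _ (Finsupp.mem_support_iff.2 h0)
    obtain ⟨p, hp⟩ := exists_cellSimplex_mem_openCell o c'
    exact Set.disjoint_left.1 (RelCWComplex.disjoint_skeletonLT_openCell (n := (n : ℕ∞)) le_rfl)
      (h1 ⟨p, rfl⟩) hp
  rw [Finsupp.sub_apply, sub_eq_zero, Finsupp.single_apply] at h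
  rw [h]
  simp [(cellSimplex_injective o n).eq_iff]

theorem sum_smul_cellChain_apply
    (hs : ∀ c, (s c - Finsupp.single (cellSimplex o c) 1).SupportedIn
      (RelCWComplex.skeletonLT Z n : Set X))
    [Fintype (RelCWComplex.cell Z n)]
    (k : RelCWComplex.cell Z n → ℤ) (c' : RelCWComplex.cell Z n) :
    (∑ c, k c • s c) (cellSimplex o c') = k c' := by
  classical
  rw [Finsupp.finsetSum_apply]
  simp [cellChain_apply_cellSimplex hs]

end Coefficients

variable [CWComplex.Finite Z] {o : CellOrientation Z}
  {inc : ∀ n : ℕ, RelCWComplex.cell Z n → RelCWComplex.cell Z (n + 1) → ℤ}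

/-- The incidence number is the coefficient of the simplex $\beta$ in $\partial s(\gamma)$, a chain
carried by $K$. If it is nonzero then $K$ contains a point of the open cell $\beta$, hence all of
it. -/
theorem IsCellularIncidence.openCell_subset (h : IsCellularIncidence o inc) {n : ℕ}
    {β : RelCWComplex.cell Z n} {γ : RelCWComplex.cell Z (n + 1)} (hβγ : inc n β γ ≠ 0)
    (K : RelCWComplex.Subcomplex Z) (hγ : RelCWComplex.openCell (n + 1) γ ⊆ (K : Set X)) :
    RelCWComplex.openCell n β ⊆ (K : Set X) := by
  obtain ⟨s, h1, h2, h3⟩ := h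
  have : Finite (RelCWComplex.cell Z n) := CWComplex.FiniteType.finite_cell n
  have := Fintype.ofFinite (RelCWComplex.cell Z n)
  have h4 := (h2 (n + 1) γ K hγ).singBoundary
  have h5 : singBoundary (s (n + 1) γ) (cellSimplex o β) = inc n β γ := by
    rw [h3, finsum_eq_sum_of_fintype]
    exact sum_smul_cellChain_apply (h1 n) (fun β => inc n β γ) β
  have h6 := h4 _ (Finsupp.mem_support_iff.2 (h5.trans_ne hβγ))
  obtain ⟨p, hp⟩ := exists_cellSimplex_mem_openCell o β
  exact openCell_subset_of_mem_of_mem K hp (h6 ⟨p, rfl⟩)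

/-- This compares the coefficients of the simplex $\alpha$ in $\partial\partial s(\gamma)=0$. -/
theorem IsCellularIncidence.sum_mul_eq_zero (h : IsCellularIncidence o inc) {n : ℕ}
    [Fintype (RelCWComplex.cell Z (n + 1))]
    (α : RelCWComplex.cell Z n) (γ : RelCWComplex.cell Z (n + 2)) :
    ∑ β, inc (n + 1) β γ * inc n α β = 0 := by
  obtain ⟨s, h1, h2, h3⟩ := h
  have : Finite (RelCWComplex.cell Z n) := CWComplex.FiniteType.finite_cell n
  have := Fintype.ofFinite (RelCWComplex.cell Z n)
  have h4 := singBoundary_singBoundary (s (n + 2) γ)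
  rw [h3, finsum_eq_sum_of_fintype, ← singBoundaryHom_apply, map_sum] at h4
  have h5 := DFunLike.congr_fun h4 (cellSimplex o α)
  rw [Finsupp.finsetSum_apply] at h5
  rw [← Finsupp.zero_apply (a := cellSimplex o α), ← h5]
  refine Finset.sum_congr rfl fun β _ => ?_
  rw [map_zsmul, singBoundaryHom_apply, h3, finsum_eq_sum_of_fintype, Finsupp.smul_apply,
    sum_smul_cellChain_apply (h1 n) (fun α => inc n α β) α, smul_eq_mul]

theorem IsCellularIncidence.cellType_subset (h : IsCellularIncidence o inc) {B : Type*}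
    (mirror : B → RelCWComplex.Subcomplex Z) {n : ℕ}
    {β : RelCWComplex.cell Z n} {γ : RelCWComplex.cell Z (n + 1)} (hβγ : inc n β γ ≠ 0) :
    BasicConstruction.cellType mirror γ ⊆ BasicConstruction.cellType mirror β :=
  fun b hb => h.openCell_subset hβγ (mirror b) hb

end Incidence

theorem BasicConstruction.WFinite.finite_special {B W : Type*} [Group W] {M : CoxeterMatrix B}
    {cs : CoxeterSystem M W} {X : Type*} [TopologicalSpace X] {Z : Set X} [CWComplex Z]
    {mirror : B → RelCWComplex.Subcomplex Z} (h : BasicConstruction.WFinite cs mirror) {n : ℕ}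
    (c : RelCWComplex.cell Z n) : Finite (cs.special (BasicConstruction.cellType mirror c)) := by
  by_contra hinf
  rw [not_finite_iff_infinite] at hinf
  obtain ⟨x, hx⟩ := RelCWComplex.openCell_nonempty n c
  refine Set.eq_empty_iff_forall_notMem.1 (h _ hinf) x
    ⟨RelCWComplex.openCell_subset_complex n c hx, ?_⟩
  exact Set.mem_iInter₂.2 fun b hb => hb hx

/-! ### Operators on Hilbert spaces -/

section HilbertSpace

open ContinuousLinearMap Filter
open scoped InnerProduct

variable {H H' : Type*} [NormedAddCommGroup H] [InnerProductSpace ℝ H]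
  [NormedAddCommGroup H'] [InnerProductSpace ℝ H']

/-- `‖p_V e‖` is the norm of the functional `⟨·, e⟩` on `V`; it increases along contractions that
preserve the functional. -/
theorem norm_starProjection_le_of_contraction (V : Submodule ℝ H) [V.HasOrthogonalProjection]
    (V' : Submodule ℝ H') [V'.HasOrthogonalProjection] (e : H) (e' : H') (θ : H → H')
    (hmem : ∀ v ∈ V, θ v ∈ V') (hnorm : ∀ v ∈ V, ‖θ v‖ ≤ ‖v‖)
    (hinner : ∀ v ∈ V, inner ℝ (θ v) e' = inner ℝ v e) :
    ‖V.starProjection e‖ ≤ ‖V'.starProjection e'‖ := by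
  set v := V.starProjection e with hv
  have hvV : v ∈ V := V.starProjection_apply_mem e
  have h1 : inner ℝ v e = ‖v‖ ^ 2 := by
    rw [← real_inner_self_eq_norm_sq]
    nth_rewrite 3 [hv]
    rw [← V.inner_starProjection_left_eq_right, V.starProjection_eq_self_iff.2 hvV]
  have h2 : inner ℝ (θ v) e' = inner ℝ (θ v) (V'.starProjection e') := by
    rw [← V'.inner_starProjection_left_eq_right, V'.starProjection_eq_self_iff.2 (hmem v hvV)]
  have h3 : ‖v‖ ^ 2 ≤ ‖v‖ * ‖V'.starProjection e'‖ := by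
    rw [← h1, ← hinner v hvV, h2]
    exact (real_inner_le_norm _ _).trans
      (mul_le_mul_of_nonneg_right (hnorm v hvV) (norm_nonneg _))
  rcases (norm_nonneg v).eq_or_lt with h0 | h0
  · rw [← h0]
    exact norm_nonneg _
  · nlinarith

/-- A uniformly bounded sequence of operators that converges on a set converges on the closed span
of the set. -/
theorem tendsto_apply_of_mem_topologicalClosure {L : ℕ → H →L[ℝ] H'} {L' : H →L[ℝ] H'} {C : ℝ}
    (hC : ∀ k x, ‖L k x‖ ≤ C * ‖x‖) (V : Submodule ℝ H)
    (hV : ∀ x ∈ V, Tendsto (fun k => L k x) atTop (𝓝 (L' x))) {x : H}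
    (hx : x ∈ V.topologicalClosure) : Tendsto (fun k => L k x) atTop (𝓝 (L' x)) := by
  rw [Metric.tendsto_atTop]
  intro ε hε
  have hC0 : 0 ≤ |C| + ‖L'‖ := by positivity
  obtain ⟨y, hy, hxy⟩ := Metric.mem_closure_iff.1 hx (ε / 2 / (|C| + ‖L'‖ + 1)) (by positivity)
  obtain ⟨N, hN⟩ := (Metric.tendsto_atTop.1 (hV y hy)) (ε / 2) (by positivity)
  refine ⟨N, fun k hk => ?_⟩
  have h1 : L k x - L' x = L k (x - y) + (L k y - L' y) + L' (y - x) := by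
    simp only [map_sub]
    abel
  have h2 := hC k (x - y)
  have h3 := L'.le_opNorm (y - x)
  have h4 := hN k hk
  rw [dist_eq_norm] at h4 hxy ⊢
  rw [norm_sub_rev y x] at h3
  rw [lt_div_iff₀ (by positivity)] at hxy
  have h5 : ‖L k (x - y)‖ ≤ |C| * ‖x - y‖ :=
    h2.trans (mul_le_mul_of_nonneg_right (le_abs_self C) (norm_nonneg _))
  rw [h1]
  have h6 := norm_add₃_le (a := L k (x - y)) (b := L k y - L' y) (c := L' (y - x))
  nlinarith [norm_nonneg (x - y)]

variable [CompleteSpace H] [CompleteSpace H']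

/-- The resolvent of `A† A` at a negative real number. -/
theorem exists_resolvent (A : H →L[ℝ] H') {ε : ℝ} (hε : 0 < ε) :
    ∃ R : H →L[ℝ] H, ∀ x y, R x = y ↔ ε • y + (A†) (A y) = x := by
  set T : H →L[ℝ] H := ε • ContinuousLinearMap.id ℝ H + A† ∘L A with hT
  have hTi : ∀ x, inner ℝ (T x) x = ε * ‖x‖ ^ 2 + ‖A x‖ ^ 2 := by
    intro x
    simp [hT, inner_add_left, inner_smul_left, ContinuousLinearMap.adjoint_inner_left]
  -- The operator $\varepsilon+A^\dagger A$ is coercive with constant $\varepsilon$, so Lax–Milgram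
  -- inverts it.
  have hco : IsCoercive (innerSL ℝ ∘L T : H →L[ℝ] H →L[ℝ] ℝ) := by
    refine ⟨ε, hε, fun x => ?_⟩
    change _ ≤ inner ℝ (T x) x
    rw [hTi]
    nlinarith [sq_nonneg ‖A x‖]
  refine ⟨hco.continuousLinearEquivOfBilin.symm, fun x y => ?_⟩
  have h : ∀ y, hco.continuousLinearEquivOfBilin y = T y := by
    intro y
    refine ext_inner_right ℝ fun w => ?_
    rw [hco.continuousLinearEquivOfBilin_apply]
    rfl
  have h1 : (hco.continuousLinearEquivOfBilin.symm : H →L[ℝ] H) x = y ↔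
      x = hco.continuousLinearEquivOfBilin y :=
    hco.continuousLinearEquivOfBilin.symm_apply_eq
  rw [h1, h, eq_comm]
  simp [hT]

/-- The orthogonal projections onto the coimage and onto the closed image of an operator `A` are
strong limits of operators `B_k A` and `A B_k`, where `B_k` commutes with everything with which `A`
and its adjoint commute. -/
theorem exists_approx_coimage_image (A : H →L[ℝ] H') :
    ∃ R : ℕ → H' →L[ℝ] H,
      (∀ (h : H →L[ℝ] H) (h' : H' →L[ℝ] H'), (∀ x, A (h x) = h' (A x)) →
        (∀ y, (A†) (h' y) = h ((A†) y)) → ∀ k y, R k (h' y) = h (R k y)) ∧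
      (∀ (V : Submodule ℝ H) [V.HasOrthogonalProjection], Vᗮ = LinearMap.ker A.toLinearMap →
        IsClosed (V : Set H) →
        ∀ x, Tendsto (fun k => R k (A x)) atTop (𝓝 (V.starProjection x))) ∧
      ∀ y, Tendsto (fun k => A (R k y)) atTop
        (𝓝 ((LinearMap.range A.toLinearMap).topologicalClosure.starProjection y)) := by
  set ε : ℕ → ℝ := fun k => 1 / ((k : ℝ) + 1) with hεdef
  have hε : ∀ k, 0 < ε k := fun k => by positivity
  have hε0 : Tendsto (fun k => √(ε k)) atTop (𝓝 0) := by
    have := (Real.continuous_sqrt.tendsto 0).comp tendsto_one_div_add_atTop_nhds_zero_nat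
    simpa [hεdef, Function.comp_def] using this
  -- Here $G_k=(\varepsilon_k+A^\dagger A)^{-1}$, and the approximating operators will be
  -- $R_k=G_kA^\dagger$.
  choose G hG using fun k => exists_resolvent A (hε k)
  have hG' : ∀ k x, ε k • G k x + (A†) (A (G k x)) = x := fun k x => (hG k x _).1 rfl
  have hAG : ∀ k x, ‖A (G k x)‖ ^ 2 + ε k * ‖G k x‖ ^ 2 = inner ℝ x (G k x) := by
    intro k x
    nth_rewrite 3 [← hG' k x]
    rw [inner_add_left, inner_smul_left, ContinuousLinearMap.adjoint_inner_left,
      real_inner_self_eq_norm_sq, real_inner_self_eq_norm_sq]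
    simp [add_comm]
  -- This bound and the next three follow from the energy identity `hAG`. They bound $AG_kA^\dagger$
  -- and $\varepsilon_kG_k$ uniformly, and bound $\varepsilon_kG_kA^\dagger$ and $\varepsilon_kAG_k$
  -- by $\sqrt{\varepsilon_k}$.
  have hb1 : ∀ k y, ‖A (G k ((A†) y))‖ ≤ ‖y‖ := by
    intro k y
    have h1 := hAG k ((A†) y)
    rw [ContinuousLinearMap.adjoint_inner_left] at h1
    have h2 := real_inner_le_norm y (A (G k ((A†) y)))
    have h3 : 0 ≤ ε k * ‖G k ((A†) y)‖ ^ 2 := mul_nonneg (hε k).le (sq_nonneg _)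
    by_contra! hlt
    nlinarith [norm_nonneg y]
  have hb2 : ∀ k y, ε k * ‖G k ((A†) y)‖ ≤ √(ε k) * ‖y‖ := by
    intro k y
    have h1 := hAG k ((A†) y)
    rw [ContinuousLinearMap.adjoint_inner_left] at h1
    have h2 := real_inner_le_norm y (A (G k ((A†) y)))
    have h3 := hb1 k y
    have h4 : ε k * ‖G k ((A†) y)‖ ^ 2 ≤ ‖y‖ ^ 2 := by nlinarith [norm_nonneg y]
    have h5 : (ε k * ‖G k ((A†) y)‖) ^ 2 ≤ (√(ε k) * ‖y‖) ^ 2 := by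
      rw [mul_pow, mul_pow, Real.sq_sqrt (hε k).le]
      nlinarith [hε k]
    exact (le_abs_self _).trans (abs_le_of_sq_le_sq h5 (by positivity))
  have hb3 : ∀ k x, ε k * ‖G k x‖ ≤ ‖x‖ := by
    intro k x
    have h1 := hAG k x
    have h2 := real_inner_le_norm x (G k x)
    rcases (norm_nonneg (G k x)).eq_or_lt with h0 | h0
    · rw [← h0, mul_zero]
      exact norm_nonneg _
    · nlinarith [sq_nonneg ‖A (G k x)‖]
  have hb4 : ∀ k x, ε k * ‖A (G k x)‖ ≤ √(ε k) * ‖x‖ := by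
    intro k x
    have h1 := hAG k x
    have h2 := real_inner_le_norm x (G k x)
    have h3 := hb3 k x
    have h4 : ε k * ‖A (G k x)‖ ^ 2 ≤ ‖x‖ ^ 2 := by
      have h6 : 0 ≤ ε k * ‖G k x‖ ^ 2 := mul_nonneg (hε k).le (sq_nonneg _)
      have h7 : ‖A (G k x)‖ ^ 2 ≤ ‖x‖ * ‖G k x‖ := by linarith
      have h8 := mul_le_mul_of_nonneg_left h7 (hε k).le
      nlinarith [norm_nonneg x]
    have h5 : (ε k * ‖A (G k x)‖) ^ 2 ≤ (√(ε k) * ‖x‖) ^ 2 := by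
      rw [mul_pow, mul_pow, Real.sq_sqrt (hε k).le]
      nlinarith [hε k]
    exact (le_abs_self _).trans (abs_le_of_sq_le_sq h5 (by positivity))
  have hGA : ∀ k x, G k ((A†) (A x)) = x - ε k • G k x := by
    intro k x
    rw [hG]
    have h1 := hG' k x
    have h2 : (A†) (A x) = (A†) (A x) + ε k • x - ε k • (ε k • G k x + (A†) (A (G k x))) := by
      rw [h1]
      abel
    rw [h2]
    simp only [map_sub, map_smul, smul_sub, smul_add]
    abel
  have hlim : ∀ c : ℝ, Tendsto (fun k => √(ε k) * c) atTop (𝓝 0) := fun c => by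
    simpa using hε0.mul_const c
  refine ⟨fun k => G k ∘L A†, ?_, ?_, ?_⟩
  · intro h h' h1 h2 k y
    simp only [ContinuousLinearMap.comp_apply]
    rw [hG, h2, h1, h2, ← map_smul, ← map_add, hG']
  · intro V _ hV hVc x
    -- The coimage is the closed range of $A^\dagger$. On the range itself the error of $R_kA$ is
    -- $\varepsilon_kG_kA^\dagger y$, of size at most $\sqrt{\varepsilon_k}\|y\|$; uniform
    -- boundedness extends the limit to the closure.
    have hVcl : V = (LinearMap.range (A†).toLinearMap).topologicalClosure := by
      rw [← Submodule.orthogonal_orthogonal_eq_closure, ContinuousLinearMap.orthogonal_range,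
        ContinuousLinearMap.adjoint_adjoint, ← hV, Submodule.orthogonal_orthogonal_eq_closure]
      exact hVc.submodule_topologicalClosure_eq.symm
    have h1 : ∀ k x, (G k ∘L A†) (A x) = (G k ∘L A† ∘L A) (V.starProjection x) := by
      intro k x
      have h2 : x - V.starProjection x ∈ LinearMap.ker A.toLinearMap := by
        rw [← hV]
        exact V.sub_starProjection_mem_orthogonal x
      have h3 : A x = A (V.starProjection x) := by
        have h4 : A (x - V.starProjection x) = 0 := h2
        rwa [map_sub, sub_eq_zero] at h4
      simp [h3]
    simp only [h1]
    refine tendsto_apply_of_mem_topologicalClosure (C := 2) (L' := ContinuousLinearMap.id ℝ H)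
      ?_ (LinearMap.range (A†).toLinearMap) ?_ (hVcl ▸ V.starProjection_apply_mem x)
    · intro k x
      simp only [ContinuousLinearMap.comp_apply]
      rw [hGA]
      have h5 := norm_sub_le x (ε k • G k x)
      rw [norm_smul, Real.norm_of_nonneg (hε k).le] at h5
      linarith [hb3 k x]
    · rintro _ ⟨y, rfl⟩
      rw [tendsto_iff_norm_sub_tendsto_zero]
      refine squeeze_zero (fun k => norm_nonneg _) (fun k => ?_) (hlim ‖y‖)
      simp only [ContinuousLinearMap.comp_apply, ContinuousLinearMap.coe_coe,
        ContinuousLinearMap.id_apply]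
      rw [hGA, sub_sub_cancel_left, norm_neg, norm_smul, Real.norm_of_nonneg (hε k).le]
      exact hb2 k y
  · intro y
    set Q := (LinearMap.range A.toLinearMap).topologicalClosure with hQ
    -- The kernel of $A^\dagger$ is the orthogonal complement of the range of $A$, so only the
    -- component of $y$ in the closed range matters.
    have h1 : ∀ k, A ((G k ∘L A†) y) = (A ∘L G k ∘L A†) (Q.starProjection y) := by
      intro k
      have h2 : y - Q.starProjection y ∈ LinearMap.ker (A†).toLinearMap := by
        rw [← ContinuousLinearMap.orthogonal_range, ← Submodule.orthogonal_closure]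
        exact Q.sub_starProjection_mem_orthogonal y
      have h3 : (A†) y = (A†) (Q.starProjection y) := by
        have h4 : (A†) (y - Q.starProjection y) = 0 := h2
        rwa [map_sub, sub_eq_zero] at h4
      simp [h3]
    simp only [h1]
    refine tendsto_apply_of_mem_topologicalClosure (C := 1) (L' := ContinuousLinearMap.id ℝ H')
      ?_ (LinearMap.range A.toLinearMap) ?_ (Q.starProjection_apply_mem y)
    · intro k y
      simpa using hb1 k y
    · rintro _ ⟨x, rfl⟩
      rw [tendsto_iff_norm_sub_tendsto_zero]
      refine squeeze_zero (fun k => norm_nonneg _) (fun k => ?_) (hlim ‖x‖)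
      simp only [ContinuousLinearMap.comp_apply, ContinuousLinearMap.coe_coe,
        ContinuousLinearMap.id_apply]
      rw [hGA, map_sub, sub_sub_cancel_left, norm_neg, map_smul, norm_smul,
        Real.norm_of_nonneg (hε k).le]
      exact hb4 k x

end HilbertSpace

section WeightedComposition

variable {ι ι' : Type*}

/-- Only indices with $a_i\ne0$ contribute, and there $\sigma$ is injective, so each coordinate of
$x$ is used at most once. -/
theorem memℓp_weightedComp (a : ι' → ℝ) (σ : ι' → ι) {C : ℝ} (ha : ∀ i, |a i| ≤ C)
    (hσ : Set.InjOn σ {i | a i ≠ 0}) (x : lp (fun _ : ι => ℝ) 2) (s : Finset ι') :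
    ∑ i ∈ s, ‖a i * x (σ i)‖ ^ (2 : ENNReal).toReal ≤ (C * ‖x‖) ^ (2 : ENNReal).toReal := by
  classical
  have hp : (0 : ℝ) < (2 : ENNReal).toReal := by norm_num
  have h1 := lp.sum_rpow_le_norm_rpow hp x ((s.filter fun i => a i ≠ 0).image σ)
  rw [Finset.sum_image (g := σ) (s := s.filter fun i => a i ≠ 0)
    (fun i hi j hj h => hσ (Finset.mem_filter.1 hi).2 (Finset.mem_filter.1 hj).2 h)] at h1
  simp only [ENNReal.toReal_ofNat, Real.rpow_ofNat] at h1 ⊢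
  calc ∑ i ∈ s, ‖a i * x (σ i)‖ ^ 2 = ∑ i ∈ s with a i ≠ 0, ‖a i * x (σ i)‖ ^ 2 := by
        rw [Finset.sum_filter]
        refine Finset.sum_congr rfl fun i _ => ?_
        split_ifs with h
        · rfl
        · simp [not_not.1 h]
    _ ≤ ∑ i ∈ s with a i ≠ 0, C ^ 2 * ‖x (σ i)‖ ^ 2 := by
        refine Finset.sum_le_sum fun i _ => ?_
        rw [norm_mul, mul_pow]
        refine mul_le_mul_of_nonneg_right ?_ (sq_nonneg _)
        exact pow_le_pow_left₀ (norm_nonneg _) (ha i) 2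
    _ ≤ (C * ‖x‖) ^ 2 := by
        rw [← Finset.mul_sum, mul_pow]
        exact mul_le_mul_of_nonneg_left h1 (sq_nonneg _)

/-- The operator `x ↦ a · (x ∘ σ)` on `ℓ²`, for a bounded function `a` on whose support `σ` is
injective. -/
noncomputable def weightedComp (a : ι' → ℝ) (σ : ι' → ι) {C : ℝ} (ha : ∀ i, |a i| ≤ C)
    (hσ : Set.InjOn σ {i | a i ≠ 0}) :
    lp (fun _ : ι => ℝ) 2 →L[ℝ] lp (fun _ : ι' => ℝ) 2 :=
  LinearMap.mkContinuous
    { toFun := fun x => ⟨fun i => a i * x (σ i), memℓp_gen' (memℓp_weightedComp a σ ha hσ x)⟩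
      map_add' := fun x y => by
        ext i
        exact mul_add _ _ _
      map_smul' := fun c x => by
        ext i
        simp [mul_left_comm] }
    |C| fun x => by
      refine lp.norm_le_of_forall_sum_le (by norm_num) (by positivity) fun s => ?_
      exact memℓp_weightedComp a σ (fun i => (ha i).trans (le_abs_self C)) hσ x s

@[simp]
theorem weightedComp_apply (a : ι' → ℝ) (σ : ι' → ι) {C : ℝ} (ha : ∀ i, |a i| ≤ C)
    (hσ : Set.InjOn σ {i | a i ≠ 0}) (x : lp (fun _ : ι => ℝ) 2) (i : ι') :
    weightedComp a σ ha hσ x i = a i * x (σ i) := rfl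

end WeightedComposition

/-! ### Weighted `L²`-spaces: coefficients and basis vectors -/

namespace WeightedL2

variable {ι : Type*} {μ : ι → ℝ}

theorem ext_coeff (hμ : ∀ c, 0 < μ c) {x y : WeightedL2 μ} (h : ∀ c, coeff μ x c = coeff μ y c) :
    x = y := by
  ext c
  have h1 := h c
  have h2 := (Real.sqrt_pos.2 (hμ c)).ne'
  rwa [coeff, coeff, div_left_inj' h2] at h1

theorem inner_basisVec_right (hμ : ∀ c, 0 < μ c) (x : WeightedL2 μ) (c : ι) :
    inner ℝ x (basisVec μ c) = coeff μ x c * μ c := by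
  classical
  refine (hasSum_inner μ hμ x (basisVec μ c)).unique ?_
  convert hasSum_single c ?_ using 1
  · rw [coeff_basisVec μ hμ]
    simp
  · intro d hd
    simp [coeff_basisVec μ hμ, hd]

theorem norm_sq_eq_tsum (hμ : ∀ c, 0 < μ c) (x : WeightedL2 μ) :
    HasSum (fun c => coeff μ x c ^ 2 * μ c) (‖x‖ ^ 2) := by
  rw [← real_inner_self_eq_norm_sq]
  refine (hasSum_inner μ hμ x x).congr_fun ?_
  intro c
  ring

theorem norm_basisVec (hμ : ∀ c, 0 < μ c) (c : ι) : ‖basisVec μ c‖ ^ 2 = μ c := by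
  classical
  rw [← real_inner_self_eq_norm_sq, inner_basisVec_right hμ, coeff_basisVec μ hμ]
  simp

end WeightedL2

theorem inner_weightedComp_of_involutive {ι : Type*} (a : ι → ℝ) (σ : ι → ι) {C : ℝ}
    (ha : ∀ i, |a i| ≤ C) (hσ : Set.InjOn σ {i | a i ≠ 0}) (hinv : Function.Involutive σ)
    (haσ : ∀ i, a (σ i) = a i) (x y : lp (fun _ : ι => ℝ) 2) :
    inner ℝ (weightedComp a σ ha hσ x) y = inner ℝ x (weightedComp a σ ha hσ y) := by
  rw [lp.inner_eq_tsum, lp.inner_eq_tsum, ← (hinv.toPerm σ).tsum_eq]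
  refine tsum_congr fun i => ?_
  simp only [Function.Involutive.coe_toPerm, weightedComp_apply, haσ, hinv i, RCLike.inner_apply,
    conj_trivial]
  ring

/-! ### The Hecke operators -/

namespace CoxeterSystem

open WeightedL2

variable {B W : Type*} [Group W] {M : CoxeterMatrix B} {cs : CoxeterSystem M W} {q : B → ℝ}
  {J J' : Type*}

theorem sumWeight_pos (hq : ∀ i, 0 < q i) (J : Type*) (p : J × W) : 0 < cs.sumWeight q J p :=
  wordWeight_pos hq p.2

open Classical in
/-- Left multiplication by `e_s` as a bounded operator on `⨁_{j ∈ J} L²_q(W)`. -/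
noncomputable def heckeOp (cs : CoxeterSystem M W) (q : B → ℝ) (J : Type*) (i : B) :
    WeightedL2 (cs.sumWeight q J) →L[ℝ] WeightedL2 (cs.sumWeight q J) :=
  weightedComp (fun _ : J × W => √(q i)) (fun p => (p.1, cs.simple i * p.2))
      (fun _ => le_rfl) (fun p _ p' _ h => by
        obtain ⟨h1, h2⟩ := Prod.mk.inj h
        exact Prod.ext h1 (mul_left_cancel h2)) +
    weightedComp (fun p : J × W =>
        if cs.length (cs.simple i * p.2) < cs.length p.2 then q i - 1 else 0) id
      (C := |q i - 1|) (fun p => by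
        split_ifs
        · exact le_rfl
        · simp) Function.injective_id.injOn

open Classical in
theorem heckeOp_apply (i : B) (x : WeightedL2 (cs.sumWeight q J)) (p : J × W) :
    (cs.heckeOp q J i x : ∀ _ : J × W, ℝ) p =
      √(q i) * (x : ∀ _ : J × W, ℝ) (p.1, cs.simple i * p.2) +
      (if cs.length (cs.simple i * p.2) < cs.length p.2 then q i - 1 else 0) *
        (x : ∀ _ : J × W, ℝ) p := rfl

/-- Passing from orthonormal coordinates to coefficients rescales by
$\sqrt{q_{sw}/q_w}=q_s^{\pm1/2}$, which turns the symmetric entry $\sqrt{q_s}$ into $1$ or $q_s$. -/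
theorem coeff_heckeOp (hq : ∀ i, 0 < q i)
    (hc : ∀ i j, IsConj (cs.simple i) (cs.simple j) → q i = q j) (i : B)
    (x : WeightedL2 (cs.sumWeight q J)) (j : J) (w : W) :
    coeff (cs.sumWeight q J) (cs.heckeOp q J i x) (j, w) =
      cs.heckeLeft q i (fun v => coeff (cs.sumWeight q J) x (j, v)) w := by
  have hqi := (Real.sqrt_pos.2 (hq i)).ne'
  have hsq := Real.mul_self_sqrt (hq i).le
  simp only [coeff, heckeOp_apply, heckeLeft, sumWeight]
  have hw := (Real.sqrt_pos.2 (wordWeight_pos (cs := cs) hq w)).ne'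
  have hsw := (Real.sqrt_pos.2 (wordWeight_pos (cs := cs) hq (cs.simple i * w))).ne'
  split_ifs with h
  · have h1 : cs.wordWeight q w = q i * cs.wordWeight q (cs.simple i * w) := by
      rw [← wordWeight_simple_mul hc]
      · simp
      · simpa using h
    have h2 : √(cs.wordWeight q w) = √(q i) * √(cs.wordWeight q (cs.simple i * w)) := by
      rw [h1, Real.sqrt_mul (hq i).le]
    rw [add_div]
    congr 1
    · rw [h2, mul_div_mul_left _ _ hqi]
    · rw [mul_div_assoc]
  · have h0 := cs.length_simple_mul_ne w i
    have h2 : √(cs.wordWeight q (cs.simple i * w)) = √(q i) * √(cs.wordWeight q w) := by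
      rw [wordWeight_simple_mul hc (by omega), Real.sqrt_mul (hq i).le]
    rw [h2, zero_mul, add_zero]
    field_simp
    rw [Real.sq_sqrt (hq i).le, mul_comm]

/-- In orthonormal coordinates $e_s$ is $\sqrt{q_s}$ times the involution $w\mapsto sw$ plus a
diagonal operator, and both are symmetric. -/
theorem inner_heckeOp (i : B) (x y : WeightedL2 (cs.sumWeight q J)) :
    inner ℝ (cs.heckeOp q J i x) y = inner ℝ x (cs.heckeOp q J i y) := by
  rw [heckeOp, _root_.add_apply, _root_.add_apply, inner_add_left,
    inner_add_right]
  congr 1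
  · refine inner_weightedComp_of_involutive _ _ _ _ ?_ ?_ _ _
    · exact fun p => by simp
    · exact fun _ => rfl
  · exact inner_weightedComp_of_involutive _ _ _ _ (fun p => rfl) (fun _ => rfl) _ _

theorem heckeOp_basisVec (hq : ∀ i, 0 < q i)
    (hc : ∀ i j, IsConj (cs.simple i) (cs.simple j) → q i = q j) {i : B} {w : W}
    (h : cs.length w < cs.length (cs.simple i * w)) (j : J) :
    cs.heckeOp q J i (basisVec (cs.sumWeight q J) (j, w)) =
      basisVec (cs.sumWeight q J) (j, cs.simple i * w) := by
  classical
  refine ext_coeff (sumWeight_pos hq J) ?_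
  rintro ⟨j', v⟩
  rw [coeff_heckeOp hq hc]
  simp only [coeff_basisVec _ (sumWeight_pos hq J), Prod.mk.injEq]
  by_cases hj : j' = j
  · have h1 := congrFun (cs.heckeLeft_single q i w) v
    rw [if_pos h] at h1
    have h2 : (Pi.single w 1 : W → ℝ) = fun v => if v = w then 1 else 0 := by
      funext v
      simp [Pi.single_apply]
    rw [h2] at h1
    simp only [hj, true_and, h1, Pi.single_apply]
  · simp [hj, heckeLeft]

/-- The product of the Hecke operators along a word. -/
noncomputable def heckeWord (cs : CoxeterSystem M W) (q : B → ℝ) (J : Type*) (ω : List B) :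
    WeightedL2 (cs.sumWeight q J) →L[ℝ] WeightedL2 (cs.sumWeight q J) :=
  (ω.map (cs.heckeOp q J)).prod

theorem heckeWord_cons (i : B) (ω : List B) (x : WeightedL2 (cs.sumWeight q J)) :
    cs.heckeWord q J (i :: ω) x = cs.heckeOp q J i (cs.heckeWord q J ω x) := by
  simp [heckeWord]

theorem inner_heckeWord (ω : List B) (x y : WeightedL2 (cs.sumWeight q J)) :
    inner ℝ (cs.heckeWord q J ω x) y = inner ℝ x (cs.heckeWord q J ω.reverse y) := by
  induction ω generalizing y with
  | nil => simp [heckeWord]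
  | cons i ω ih =>
    rw [heckeWord_cons, inner_heckeOp, ih]
    simp [heckeWord]

theorem heckeWord_basisVec (hq : ∀ i, 0 < q i)
    (hc : ∀ i j, IsConj (cs.simple i) (cs.simple j) → q i = q j) {ω : List B}
    (hω : cs.IsReduced ω) (j : J) :
    cs.heckeWord q J ω (basisVec (cs.sumWeight q J) (j, 1)) =
      basisVec (cs.sumWeight q J) (j, cs.wordProd ω) := by
  induction ω with
  | nil => simp [heckeWord]
  | cons i ω ih =>
    have h1 : cs.IsReduced ω := by simpa using hω.drop 1
    rw [heckeWord_cons, ih h1, cs.wordProd_cons, heckeOp_basisVec hq hc]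
    rw [← cs.wordProd_cons, hω.eq, h1.eq]
    simp

/-- `φ` commutes with the action of the Hecke algebra. -/
def HeckeCommute (cs : CoxeterSystem M W) (q : B → ℝ) {J J' : Type*}
    (φ : WeightedL2 (cs.sumWeight q J) →L[ℝ] WeightedL2 (cs.sumWeight q J')) : Prop :=
  ∀ i x, φ (cs.heckeOp q J i x) = cs.heckeOp q J' i (φ x)

namespace HeckeCommute

variable {φ : WeightedL2 (cs.sumWeight q J) →L[ℝ] WeightedL2 (cs.sumWeight q J')}

theorem heckeWord (hφ : cs.HeckeCommute q φ) (ω : List B) (x : WeightedL2 (cs.sumWeight q J)) :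
    φ (cs.heckeWord q J ω x) = cs.heckeWord q J' ω (φ x) := by
  induction ω with
  | nil => simp [CoxeterSystem.heckeWord]
  | cons i ω ih => rw [heckeWord_cons, heckeWord_cons, hφ, ih]

theorem adjoint (hφ : cs.HeckeCommute q φ) :
    cs.HeckeCommute q (ContinuousLinearMap.adjoint φ) := by
  intro i y
  refine ext_inner_right ℝ fun x => ?_
  rw [ContinuousLinearMap.adjoint_inner_left, inner_heckeOp, ← hφ, inner_heckeOp,
    ContinuousLinearMap.adjoint_inner_left]

theorem comp {J'' : Type*} (hφ : cs.HeckeCommute q φ)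
    {ψ : WeightedL2 (cs.sumWeight q J') →L[ℝ] WeightedL2 (cs.sumWeight q J'')}
    (hψ : cs.HeckeCommute q ψ) : cs.HeckeCommute q (ψ ∘L φ) := by
  intro i x
  rw [ContinuousLinearMap.comp_apply, hφ, hψ, ContinuousLinearMap.comp_apply]

/-- The operator $e_w$ commutes with $\varphi$ and has adjoint $e_{w^{-1}}$, so it moves to the
other side. Thus $\varphi$ is determined by its values on the vectors $e_1^j$. -/
theorem inner_basisVec (hφ : cs.HeckeCommute q φ) (hq : ∀ i, 0 < q i)
    (hc : ∀ i j, IsConj (cs.simple i) (cs.simple j) → q i = q j) (j : J) (j' : J') (w : W) :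
    inner ℝ (φ (basisVec (cs.sumWeight q J) (j, w))) (basisVec (cs.sumWeight q J') (j', 1)) =
      inner ℝ (φ (basisVec (cs.sumWeight q J) (j, 1)))
        (basisVec (cs.sumWeight q J') (j', w⁻¹)) := by
  obtain ⟨ω, hω, rfl⟩ := cs.exists_isReduced w
  rw [← heckeWord_basisVec hq hc hω, hφ.heckeWord, inner_heckeWord,
    heckeWord_basisVec hq hc hω.reverse, cs.wordProd_reverse]

/-- A diagonal entry of $\varphi\psi$ is expanded as $\langle\psi e_1,\varphi^\dagger e_1\rangle$
over the basis of the middle space. Rewriting the coefficients of $\varphi^\dagger e_1$ through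
those of $\varphi e_1$ makes the formula symmetric up to $w\mapsto w^{-1}$. -/
theorem hasSum_inner_comp (hq : ∀ i, 0 < q i)
    (hc : ∀ i j, IsConj (cs.simple i) (cs.simple j) → q i = q j)
    (ψ : WeightedL2 (cs.sumWeight q J') →L[ℝ] WeightedL2 (cs.sumWeight q J))
    (hφ : cs.HeckeCommute q φ) (j' : J') :
    HasSum (fun p : J × W => coeff (cs.sumWeight q J) (ψ (basisVec _ (j', 1))) p *
        coeff (cs.sumWeight q J') (φ (basisVec _ (p.1, 1))) (j', p.2⁻¹) * cs.wordWeight q p.2)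
      (inner ℝ ((φ ∘L ψ) (basisVec (cs.sumWeight q J') (j', 1)))
        (basisVec (cs.sumWeight q J') (j', 1))) := by
  rw [ContinuousLinearMap.comp_apply, ← ContinuousLinearMap.adjoint_inner_right]
  refine (hasSum_inner _ (sumWeight_pos hq J) _ _).congr_fun ?_
  rintro ⟨j, w⟩
  have h1 := inner_basisVec_right (sumWeight_pos hq J)
    (ContinuousLinearMap.adjoint φ (basisVec (cs.sumWeight q J') (j', 1))) (j, w)
  rw [ContinuousLinearMap.adjoint_inner_left, real_inner_comm, hφ.inner_basisVec hq hc,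
    inner_basisVec_right (sumWeight_pos hq J')] at h1
  simp only [sumWeight, wordWeight_inv hc] at h1
  rw [mul_assoc, h1, mul_assoc]
  rfl

theorem vnTrace_comp_eq [Fintype J] [Fintype J'] (hq : ∀ i, 0 < q i)
    (hc : ∀ i j, IsConj (cs.simple i) (cs.simple j) → q i = q j)
    (ψ : WeightedL2 (cs.sumWeight q J') →L[ℝ] WeightedL2 (cs.sumWeight q J))
    (hφ : cs.HeckeCommute q φ) :
    cs.vnTrace q (φ ∘L ψ) = ∑ j' : J', ∑ j : J, ∑' w : W,
      coeff (cs.sumWeight q J) (ψ (basisVec _ (j', 1))) (j, w) *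
        coeff (cs.sumWeight q J') (φ (basisVec _ (j, 1))) (j', w⁻¹) * cs.wordWeight q w := by
  rw [vnTrace, finsum_eq_sum_of_fintype]
  refine Finset.sum_congr rfl fun j' _ => ?_
  have h := hasSum_inner_comp hq hc ψ hφ j'
  rw [← h.tsum_eq, h.summable.tsum_prod, tsum_fintype]

/-- The trace property. -/
theorem vnTrace_comp_comm [Finite J] [Finite J'] (hq : ∀ i, 0 < q i)
    (hc : ∀ i j, IsConj (cs.simple i) (cs.simple j) → q i = q j)
    {ψ : WeightedL2 (cs.sumWeight q J') →L[ℝ] WeightedL2 (cs.sumWeight q J)}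
    (hφ : cs.HeckeCommute q φ) (hψ : cs.HeckeCommute q ψ) :
    cs.vnTrace q (φ ∘L ψ) = cs.vnTrace q (ψ ∘L φ) := by
  have := Fintype.ofFinite J
  have := Fintype.ofFinite J'
  rw [vnTrace_comp_eq hq hc ψ hφ, vnTrace_comp_eq hq hc φ hψ, Finset.sum_comm]
  refine Finset.sum_congr rfl fun j _ => Finset.sum_congr rfl fun j' _ => ?_
  -- The substitution $w\mapsto w^{-1}$ exchanges the two factors and preserves the weight, as
  -- $q_{w^{-1}}=q_w$.
  rw [← (Equiv.inv W).tsum_eq]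
  refine tsum_congr fun w => ?_
  simp only [Equiv.inv_apply, inv_inv, wordWeight_inv hc]
  ring

/-- The coimage and the closed image of an operator that commutes with the Hecke algebra have the
same trace. -/
theorem vnTrace_coimage_eq [Finite J] [Finite J'] (hq : ∀ i, 0 < q i)
    (hc : ∀ i j, IsConj (cs.simple i) (cs.simple j) → q i = q j)
    (hφ : cs.HeckeCommute q φ) (V : Submodule ℝ (WeightedL2 (cs.sumWeight q J)))
    [V.HasOrthogonalProjection] (hV : Vᗮ = LinearMap.ker φ.toLinearMap)
    (hVc : IsClosed (V : Set (WeightedL2 (cs.sumWeight q J)))) :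
    cs.vnTrace q V.starProjection =
      cs.vnTrace q (LinearMap.range φ.toLinearMap).topologicalClosure.starProjection := by
  have := Fintype.ofFinite J
  have := Fintype.ofFinite J'
  obtain ⟨R, hR, hR1, hR2⟩ := exists_approx_coimage_image φ
  have hRc : ∀ k, cs.HeckeCommute q (R k) := fun k i y =>
    hR (cs.heckeOp q J i) (cs.heckeOp q J' i) (hφ i) (hφ.adjoint i) k y
  -- The trace is a finite sum of matrix coefficients, so strong convergence is enough.
  have h1 : Filter.Tendsto (fun k => cs.vnTrace q (R k ∘L φ)) Filter.atTop
      (𝓝 (cs.vnTrace q V.starProjection)) := by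
    simp only [vnTrace, finsum_eq_sum_of_fintype]
    exact tendsto_finsetSum _ fun j _ => (hR1 V hV hVc _).inner tendsto_const_nhds
  have h2 : Filter.Tendsto (fun k => cs.vnTrace q (φ ∘L R k)) Filter.atTop
      (𝓝 (cs.vnTrace q
        (LinearMap.range φ.toLinearMap).topologicalClosure.starProjection)) := by
    simp only [vnTrace, finsum_eq_sum_of_fintype]
    exact tendsto_finsetSum _ fun j _ => (hR2 _).inner tendsto_const_nhds
  refine tendsto_nhds_unique h1 (h2.congr fun k => ?_)
  exact vnTrace_comp_comm hq hc hφ (hRc k)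

end HeckeCommute

end CoxeterSystem

theorem HasSum.prod_mul_fintype {α β : Type*} [Fintype β] {f : α → ℝ} {g : β → ℝ} {a : ℝ}
    (hf : ∀ x, 0 ≤ f x) (hg : ∀ y, 0 ≤ g y) (ha : HasSum f a) :
    HasSum (fun p : α × β => f p.1 * g p.2) (a * ∑ y, g y) :=
  ha.mul (hasSum_fintype g) (ha.summable.mul_of_nonneg (hasSum_fintype g).summable hf hg)

/-! ### Cosets of special subgroups -/

namespace CoxeterSystem

variable {B W : Type*} [Group W] {M : CoxeterMatrix B} {cs : CoxeterSystem M W} {q : B → ℝ}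

/-- Every element is the product of the shortest element of its coset with an element of `W_T`. -/
theorem exists_shortest_mul_eq {T : Set B} (w : W) :
    ∃ v ∈ cs.special T, w = cs.shortest (w : W ⧸ cs.special T) * v := by
  refine ⟨(cs.shortest (w : W ⧸ cs.special T))⁻¹ * w, ?_, by simp⟩
  rw [← QuotientGroup.eq, mk_shortest]

theorem shortest_mul_bijective (T : Set B) :
    Function.Bijective fun p : (W ⧸ cs.special T) × cs.special T => cs.shortest p.1 * (p.2 : W) := by
  constructor
  · rintro ⟨x, v⟩ ⟨x', v'⟩ h
    dsimp only at h
    have h1 : x = x' := by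
      rw [← mk_shortest x, ← mk_shortest x', ← QuotientGroup.mk_mul_of_mem _ v.2, h,
        QuotientGroup.mk_mul_of_mem _ v'.2]
    subst h1
    exact Prod.ext rfl (Subtype.ext (mul_left_cancel h))
  · intro w
    obtain ⟨v, hv, h⟩ := exists_shortest_mul_eq (cs := cs) (T := T) w
    exact ⟨⟨_, ⟨v, hv⟩⟩, h.symm⟩

/-- Summation over `W` of a function that is constant on the cosets of `W_T`. -/
theorem hasSum_mul_wordWeight (hq : ∀ i, 0 < q i)
    (hc : ∀ i j, IsConj (cs.simple i) (cs.simple j) → q i = q j) {T : Set B}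
    [Finite (cs.special T)] {f : W ⧸ cs.special T → ℝ} (hf : ∀ x, 0 ≤ f x) {a : ℝ}
    (ha : HasSum (fun x => f x * cs.wordWeight q (cs.shortest x)) a) :
    HasSum (fun w : W => f (w : W ⧸ cs.special T) * cs.wordWeight q w) (a * cs.growth q T) := by
  have := Fintype.ofFinite (cs.special T)
  rw [growth, finsum_eq_sum_of_fintype]
  have h2 := HasSum.prod_mul_fintype (fun x => mul_nonneg (hf x) (wordWeight_pos hq _).le)
    (g := fun v : cs.special T => cs.wordWeight q (v : W)) (fun v => (wordWeight_pos hq _).le) ha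
  refine (Equiv.hasSum_iff (Equiv.ofBijective _ (shortest_mul_bijective (cs := cs) T))).1
    (h2.congr_fun fun p => ?_)
  change f ((cs.shortest p.1 * (p.2 : W) : W) : W ⧸ cs.special T) *
    cs.wordWeight q (cs.shortest p.1 * (p.2 : W)) = _
  rw [wordWeight_shortest_mul hc p.1 p.2.2, QuotientGroup.mk_mul_of_mem _ p.2.2, mk_shortest]
  ring

/-- The Hecke algebra preserves the functions that are constant on the cosets of `W_T`. -/
theorem heckeLeft_mul_of_mem {T : Set B} (i : B) {f : W → ℝ}
    (hf : ∀ w, ∀ v ∈ cs.special T, f (w * v) = f w) (w : W) {v : W} (hv : v ∈ cs.special T) :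
    cs.heckeLeft q i f (w * v) = cs.heckeLeft q i f w := by
  have h1 : f (cs.simple i * (w * v)) = f (cs.simple i * w) := by
    rw [← mul_assoc]
    exact hf _ v hv
  simp only [heckeLeft, h1, hf w v hv]
  by_cases h : cs.length (cs.simple i * w) < cs.length w ↔
      cs.length (cs.simple i * (w * v)) < cs.length (w * v)
  · simp only [h]
  -- If the descents differ, then $s$ fixes the coset, so $f(sw)=f(w)$ and both branches of the
  -- Hecke formula equal $q_sf(w)$.
  · have h2 := cs.mk_simple_mul_eq_of_descent_change hv h
    rw [QuotientGroup.eq] at h2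
    have h3 := hf (cs.simple i * w) _ h2
    rw [mul_inv_cancel_left] at h3
    rw [← h3]
    split_ifs <;> ring

end CoxeterSystem

noncomputable instance CWComplex.fintypeCell {X : Type*} [TopologicalSpace X] {Z : Set X}
    [CWComplex Z] [CWComplex.Finite Z] (n : ℕ) : Fintype (RelCWComplex.cell Z n) :=
  have : Finite (RelCWComplex.cell Z n) := CWComplex.FiniteType.finite_cell n
  Fintype.ofFinite _

/-! ### The isometric embedding of the cochains -/

namespace BasicConstruction

open WeightedL2 CoxeterSystem

variable {B W : Type*} [Group W] {M : CoxeterMatrix B} {cs : CoxeterSystem M W} {q : B → ℝ}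
  {X : Type*} [TopologicalSpace X] {Z : Set X} [CWComplex Z]
  {mirror : B → RelCWComplex.Subcomplex Z} {n : ℕ}

theorem cellWeight_pos (hq : ∀ i, 0 < q i) (n : ℕ) (σ : Cell cs mirror n) :
    0 < cellWeight cs mirror q n σ := wordWeight_pos hq _

/-- This makes evaluation at $1c$ the inner product with the same indicator function for all
parameters, so that different $\mathbf q$ can be compared. -/
theorem cellWeight_translate_one (c : RelCWComplex.cell Z n) :
    cellWeight cs mirror q n (translate cs mirror 1 c) = 1 := by
  rw [cellWeight, translate, shortest_mk_one, wordWeight_one]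

theorem translate_mul {c : RelCWComplex.cell Z n} (w : W) {v : W}
    (hv : v ∈ cs.special (cellType mirror c)) :
    translate cs mirror (w * v) c = translate cs mirror w c := by
  rw [translate, translate, QuotientGroup.mk_mul_of_mem _ hv]

theorem exists_translate_eq (σ : Cell cs mirror n) : ∃ w c, translate cs mirror w c = σ := by
  obtain ⟨c, x⟩ := σ
  obtain ⟨w, rfl⟩ := QuotientGroup.mk_surjective x
  exact ⟨w, c, rfl⟩

theorem growth_pos (hq : ∀ i, 0 < q i) (hm : WFinite cs mirror) (c : RelCWComplex.cell Z n) :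
    0 < cs.growth q (cellType mirror c) := by
  have := hm.finite_special c
  exact one_pos.trans_le (one_le_growth hq _)

variable [CWComplex.Finite Z]

/-- A coset $uW_T$ has total weight $q_uW_T(\mathbf q)$, and the square of the normalizing factor
cancels $W_T(\mathbf q)$. -/
theorem hasSum_embed (hq : ∀ i, 0 < q i)
    (hc : ∀ i j, IsConj (cs.simple i) (cs.simple j) → q i = q j) (hm : WFinite cs mirror)
    (x : Cochain cs mirror q n) :
    HasSum (fun p : RelCWComplex.cell Z n × W => (value cs mirror q x (translate cs mirror p.2 p.1) /
      √(cs.growth q (cellType mirror p.1))) ^ 2 * cs.sumWeight q _ p) (‖x‖ ^ 2) := by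
  have h1 := norm_sq_eq_tsum (cellWeight_pos (cs := cs) (mirror := mirror) hq n) x
  have h2 : ∀ c : RelCWComplex.cell Z n, HasSum (fun w => (value cs mirror q x
      (translate cs mirror w c) / √(cs.growth q (cellType mirror c))) ^ 2 * cs.wordWeight q w)
      (∑' y, value cs mirror q x ⟨c, y⟩ ^ 2 * cellWeight cs mirror q n ⟨c, y⟩) := by
    intro c
    have := hm.finite_special c
    have hg := growth_pos hq hm c
    have h3 := (h1.summable.sigma_factor c).hasSum.div_const (cs.growth q (cellType mirror c))
    have h4 := hasSum_mul_wordWeight hq hc (T := cellType mirror c)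
      (f := fun y => (value cs mirror q x ⟨c, y⟩ / √(cs.growth q (cellType mirror c))) ^ 2)
      (fun y => sq_nonneg _) (h3.congr_fun fun y => by
        rw [div_pow, Real.sq_sqrt hg.le, cellWeight, div_mul_eq_mul_div])
    rwa [div_mul_cancel₀ _ hg.ne'] at h4
  have h5 : Summable fun p : RelCWComplex.cell Z n × W => (value cs mirror q x
      (translate cs mirror p.2 p.1) / √(cs.growth q (cellType mirror p.1))) ^ 2 *
        cs.sumWeight q _ p := by
    rw [summable_prod_of_nonneg fun p => mul_nonneg (sq_nonneg _) (sumWeight_pos hq _ p).le]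
    exact ⟨fun c => (h2 c).summable, (hasSum_fintype _).summable⟩
  have h6 : ∑' p : RelCWComplex.cell Z n × W, (value cs mirror q x
      (translate cs mirror p.2 p.1) / √(cs.growth q (cellType mirror p.1))) ^ 2 *
        cs.sumWeight q _ p = ‖x‖ ^ 2 := by
    rw [h5.tsum_prod, ← h1.tsum_eq, h1.summable.tsum_sigma]
    exact tsum_congr fun c => (h2 c).tsum_eq
  exact h6 ▸ h5.hasSum

/-- The isometric embedding of the weighted `L²`-cochains into `⨁_{c ∈ Z^(n)} L²_q(W)`. -/
noncomputable def embedIso (hq : ∀ i, 0 < q i)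
    (hc : ∀ i j, IsConj (cs.simple i) (cs.simple j) → q i = q j) (hm : WFinite cs mirror) (n : ℕ) :
    Cochain cs mirror q n →ₗᵢ[ℝ] WeightedL2 (cs.sumWeight q (RelCWComplex.cell Z n)) :=
  have hx := fun x : Cochain cs mirror q n =>
    exists_coeff_eq _ (sumWeight_pos hq _) _ (hasSum_embed hq hc hm x).summable
  { toFun := fun x => (hx x).choose
    map_add' := fun x y => by
      refine ext_coeff (sumWeight_pos hq _) fun p => ?_
      rw [coeff_add, (hx x).choose_spec, (hx y).choose_spec, (hx (x + y)).choose_spec]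
      dsimp only [value]
      rw [coeff_add, add_div]
    map_smul' := fun a x => by
      refine ext_coeff (sumWeight_pos hq _) fun p => ?_
      rw [RingHom.id_apply, coeff_smul, (hx x).choose_spec, (hx (a • x)).choose_spec]
      dsimp only [value]
      rw [coeff_smul, mul_div_assoc]
    norm_map' := fun x => by
      have h1 := norm_sq_eq_tsum (sumWeight_pos (cs := cs) hq _) (hx x).choose
      rw [(hx x).choose_spec] at h1
      exact (sq_eq_sq₀ (norm_nonneg _) (norm_nonneg _)).1 (h1.unique (hasSum_embed hq hc hm x)) }

section Embedding

variable (hq : ∀ i, 0 < q i) (hc : ∀ i j, IsConj (cs.simple i) (cs.simple j) → q i = q j)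
  (hm : WFinite cs mirror)

theorem coeff_embedIso (x : Cochain cs mirror q n) (c : RelCWComplex.cell Z n) (w : W) :
    coeff (cs.sumWeight q _) (embedIso hq hc hm n x) (c, w) =
      value cs mirror q x (translate cs mirror w c) / √(cs.growth q (cellType mirror c)) := by
  have hx := exists_coeff_eq _ (sumWeight_pos hq _) _ (hasSum_embed hq hc hm x).summable
  exact congrFun hx.choose_spec (c, w)

theorem embed_eq_map (V : Submodule ℝ (Cochain cs mirror q n)) :
    embed cs mirror q V = V.map (embedIso hq hc hm n).toLinearMap := by
  ext y
  constructor
  · rintro ⟨x, hx, h⟩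
    refine ⟨x, hx, ext_coeff (sumWeight_pos hq _) ?_⟩
    rintro ⟨c, w⟩
    rw [h]
    exact coeff_embedIso hq hc hm x c w
  · rintro ⟨x, hx, rfl⟩
    exact ⟨x, hx, fun c w => coeff_embedIso hq hc hm x c w⟩

/-- A coset-constant vector is recovered from its values at shortest representatives. Whether an
operator preserves the image can thus be checked on coefficients. -/
theorem exists_embedIso_eq_iff (y : WeightedL2 (cs.sumWeight q (RelCWComplex.cell Z n))) :
    (∃ x, embedIso hq hc hm n x = y) ↔ ∀ c w, ∀ v ∈ cs.special (cellType mirror c),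
      coeff (cs.sumWeight q _) y (c, w * v) = coeff (cs.sumWeight q _) y (c, w) := by
  constructor
  · rintro ⟨x, rfl⟩ c w v hv
    rw [coeff_embedIso, coeff_embedIso, translate_mul w hv]
  · intro h
    have h1 := (norm_sq_eq_tsum (sumWeight_pos hq _) y).summable
    have hinj : Function.Injective fun σ : Cell cs mirror n => (σ.1, cs.shortest σ.2) := by
      rintro ⟨c, x⟩ ⟨c', x'⟩ h
      obtain ⟨h1, h2⟩ := Prod.mk.inj h
      dsimp only at h1 h2
      subst h1
      rw [← mk_shortest x, ← mk_shortest x', h2]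
    -- The factor bounds all the growth values $W_{S(c)}(\mathbf q)$ at once; it exists because
    -- there are finitely many $n$-cells.
    have h2 := (h1.comp_injective hinj).mul_left
      (∑ c : RelCWComplex.cell Z n, cs.growth q (cellType mirror c))
    obtain ⟨x, hx⟩ := exists_coeff_eq (cellWeight cs mirror q n) (cellWeight_pos hq n)
      (fun σ => coeff (cs.sumWeight q _) y (σ.1, cs.shortest σ.2) *
        √(cs.growth q (cellType mirror σ.1))) (by
      refine h2.of_nonneg_of_le (fun σ => mul_nonneg (sq_nonneg _) (cellWeight_pos hq n σ).le) ?_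
      intro σ
      rw [mul_pow, Real.sq_sqrt (growth_pos hq hm σ.1).le, mul_comm (_ ^ 2), mul_assoc]
      refine mul_le_mul_of_nonneg_right ?_
        (mul_nonneg (sq_nonneg _) (cellWeight_pos hq n σ).le)
      exact Finset.single_le_sum (f := fun c => cs.growth q (cellType mirror c))
        (fun c _ => (growth_pos hq hm c).le) (Finset.mem_univ σ.1))
    refine ⟨x, ext_coeff (sumWeight_pos hq _) ?_⟩
    rintro ⟨c, w⟩
    rw [coeff_embedIso, value, hx]
    dsimp only [translate]
    rw [mul_div_cancel_right₀ _ (Real.sqrt_pos.2 (growth_pos hq hm c)).ne']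
    obtain ⟨v, hv, hw⟩ := exists_shortest_mul_eq (cs := cs) (T := cellType mirror c) w
    conv_rhs => rw [hw]
    exact (h c _ v hv).symm

theorem exists_embedIso_eq_heckeOp (i : B) (x : Cochain cs mirror q n) :
    ∃ x', embedIso hq hc hm n x' = cs.heckeOp q _ i (embedIso hq hc hm n x) := by
  rw [exists_embedIso_eq_iff]
  intro c w v hv
  rw [coeff_heckeOp hq hc, coeff_heckeOp hq hc]
  refine heckeLeft_mul_of_mem i (fun w v hv => ?_) w hv
  exact (exists_embedIso_eq_iff hq hc hm _).1 ⟨x, rfl⟩ c w v hv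

theorem adjoint_embedIso_apply (x : Cochain cs mirror q n) :
    ContinuousLinearMap.adjoint (embedIso hq hc hm n).toContinuousLinearMap
      (embedIso hq hc hm n x) = x := by
  refine ext_inner_right ℝ fun y => ?_
  rw [ContinuousLinearMap.adjoint_inner_left]
  exact (embedIso hq hc hm n).inner_map_map x y

/-- The orthogonal projection onto the image of the cochains. -/
noncomputable def embedProj : WeightedL2 (cs.sumWeight q (RelCWComplex.cell Z n)) →L[ℝ]
    WeightedL2 (cs.sumWeight q (RelCWComplex.cell Z n)) :=
  (embedIso hq hc hm n).toContinuousLinearMap ∘L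
    ContinuousLinearMap.adjoint (embedIso hq hc hm n).toContinuousLinearMap

theorem embedProj_apply (y : WeightedL2 (cs.sumWeight q (RelCWComplex.cell Z n))) :
    embedProj hq hc hm y = embedIso hq hc hm n
      (ContinuousLinearMap.adjoint (embedIso hq hc hm n).toContinuousLinearMap y) := rfl

/-- A self-adjoint operator that preserves a closed subspace commutes with the projection onto it.
-/
theorem heckeCommute_embedProj : cs.HeckeCommute q (embedProj (n := n) hq hc hm) := by
  intro i y
  obtain ⟨x, hx⟩ := exists_embedIso_eq_heckeOp hq hc hm i
    (ContinuousLinearMap.adjoint (embedIso hq hc hm n).toContinuousLinearMap y)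
  rw [embedProj_apply, embedProj_apply, ← hx]
  congr 1
  refine ext_inner_right ℝ fun z => ?_
  obtain ⟨z', hz'⟩ := exists_embedIso_eq_heckeOp hq hc hm i z
  rw [ContinuousLinearMap.adjoint_inner_left, inner_heckeOp]
  change inner ℝ y (cs.heckeOp q _ i (embedIso hq hc hm n z)) = _
  rw [← hz', ← (embedIso hq hc hm n).inner_map_map x z, hx, inner_heckeOp, ← hz',
    (embedIso hq hc hm n).inner_map_map, ContinuousLinearMap.adjoint_inner_left]
  rfl

end Embedding

theorem vnDim_embed (hq : ∀ i, 0 < q i)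
    (hc : ∀ i j, IsConj (cs.simple i) (cs.simple j) → q i = q j) (hm : WFinite cs mirror)
    (V : Submodule ℝ (Cochain cs mirror q n)) :
    cs.vnDim q (embed cs mirror q V) = ∑ c : RelCWComplex.cell Z n,
      ‖V.topologicalClosure.starProjection
        (basisVec (cellWeight cs mirror q n) (translate cs mirror 1 c))‖ ^ 2 /
          cs.growth q (cellType mirror c) := by
  rw [vnDim, vnTrace, finsum_eq_sum_of_fintype]
  refine Finset.sum_congr rfl fun c => fun _ => ?_
  set Φ := embedIso hq hc hm n with hΦ
  set U := (embed cs mirror q V).topologicalClosure with hU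
  set g := cs.growth q (cellType mirror c) with hg
  have hg0 : 0 < g := growth_pos hq hm c
  set e := basisVec (cs.sumWeight q (RelCWComplex.cell Z n)) (c, 1) with he
  set e' := basisVec (cellWeight cs mirror q n) (translate cs mirror 1 c) with he'
  have hUmap : ∀ y ∈ U, ∃ x ∈ V.topologicalClosure, Φ x = y := by
    intro y hy
    have hcl : IsClosed ((V.topologicalClosure.map Φ.toLinearMap : Submodule ℝ _) :
        Set (WeightedL2 (cs.sumWeight q (RelCWComplex.cell Z n)))) := by
      rw [Submodule.map_coe]
      exact Φ.isometry.isClosedEmbedding.isClosedMap _ V.isClosed_topologicalClosure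
    have hle : U ≤ V.topologicalClosure.map Φ.toLinearMap := by
      refine Submodule.topologicalClosure_minimal _ ?_ hcl
      rw [embed_eq_map hq hc hm]
      exact Submodule.map_mono V.le_topologicalClosure
    exact hle hy
  have hmapU : ∀ x ∈ V.topologicalClosure, Φ x ∈ U := by
    intro x hx
    refine map_mem_closure Φ.continuous hx fun x hx => ?_
    rw [SetLike.mem_coe, embed_eq_map hq hc hm]
    exact ⟨x, hx, rfl⟩
  have hinner : ∀ x, inner ℝ (Φ x) e = inner ℝ x ((√g)⁻¹ • e') := by
    intro x
    rw [inner_smul_right, inner_basisVec_right (sumWeight_pos hq _),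
      inner_basisVec_right (cellWeight_pos hq n), cellWeight_translate_one, coeff_embedIso,
      sumWeight, wordWeight_one, mul_one, mul_one, div_eq_inv_mul]
  -- `norm_starProjection_le_of_contraction` is applied both ways, with $\Phi$ and its adjoint,
  -- which are inverse isometries between the closure of $V$ and $U$.
  have h1 : ‖U.starProjection e‖ = ‖V.topologicalClosure.starProjection ((√g)⁻¹ • e')‖ := by
    refine le_antisymm ?_ ?_
    · refine norm_starProjection_le_of_contraction _ _ _ _
        (ContinuousLinearMap.adjoint Φ.toContinuousLinearMap) ?_ ?_ ?_
      · intro y hy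
        obtain ⟨x, hx, rfl⟩ := hUmap y hy
        rwa [adjoint_embedIso_apply]
      · intro y hy
        obtain ⟨x, hx, rfl⟩ := hUmap y hy
        rw [adjoint_embedIso_apply, Φ.norm_map]
      · intro y hy
        obtain ⟨x, hx, rfl⟩ := hUmap y hy
        rw [adjoint_embedIso_apply, hinner]
    · exact norm_starProjection_le_of_contraction _ _ _ _ Φ hmapU (fun x _ => (Φ.norm_map x).le)
        fun x _ => hinner x
  have h2 : inner ℝ (U.starProjection e) e = ‖U.starProjection e‖ ^ 2 := by
    rw [← real_inner_self_eq_norm_sq, U.inner_starProjection_left_eq_right,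
      U.inner_starProjection_left_eq_right,
      U.starProjection_eq_self_iff.2 (U.starProjection_apply_mem e)]
  rw [h2, h1, map_smul, norm_smul, mul_pow, norm_inv, inv_pow, Real.norm_eq_abs, sq_abs,
    Real.sq_sqrt hg0.le, div_eq_inv_mul]

end BasicConstruction

/-! ### Projections onto relative orthogonal complements -/

section Projections

variable {H : Type*} [NormedAddCommGroup H] [InnerProductSpace ℝ H]

theorem norm_sq_starProjection_orthogonal (V : Submodule ℝ H) [V.HasOrthogonalProjection] (e : H) :
    ‖Vᗮ.starProjection e‖ ^ 2 = ‖e‖ ^ 2 - ‖V.starProjection e‖ ^ 2 := by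
  have h := V.norm_sq_eq_add_norm_sq_starProjection e
  linarith

/-- For $U\le V$ the projection onto $V\cap U^\perp$ is $p_{U^\perp}p_V$, and $p_Up_V=p_U$; the rest
is Pythagoras. -/
theorem norm_sq_starProjection_inf_orthogonal (V U : Submodule ℝ H) [V.HasOrthogonalProjection]
    [U.HasOrthogonalProjection] [(V ⊓ Uᗮ).HasOrthogonalProjection] (h : U ≤ V) (e : H) :
    ‖(V ⊓ Uᗮ).starProjection e‖ ^ 2 = ‖V.starProjection e‖ ^ 2 - ‖U.starProjection e‖ ^ 2 := by
  have hU : U.starProjection (V.starProjection e) = U.starProjection e := by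
    have h1 : U.starProjection (e - V.starProjection e) = 0 := by
      rw [Submodule.starProjection_apply_eq_zero_iff]
      exact Submodule.orthogonal_le h (V.sub_starProjection_mem_orthogonal e)
    rw [map_sub, sub_eq_zero] at h1
    exact h1.symm
  have h2 : (V ⊓ Uᗮ).starProjection e = Uᗮ.starProjection (V.starProjection e) := by
    have h3 : Uᗮ.starProjection (V.starProjection e) =
        V.starProjection e - U.starProjection (V.starProjection e) := by
      have := U.starProjection_add_starProjection_orthogonal (V.starProjection e)
      rw [eq_sub_iff_add_eq, add_comm]
      exact this
    refine Submodule.eq_starProjection_of_mem_of_inner_eq_zero ⟨?_, ?_⟩ ?_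
    · rw [h3]
      exact V.sub_mem (V.starProjection_apply_mem e) (h (U.starProjection_apply_mem _))
    · exact Uᗮ.starProjection_apply_mem _
    · rintro w ⟨hwV, hwU⟩
      rw [h3, ← sub_add, inner_add_left]
      have h4 : inner ℝ (e - V.starProjection e) w = 0 :=
        Submodule.inner_left_of_mem_orthogonal hwV (V.sub_starProjection_mem_orthogonal e)
      have h5 : inner ℝ (U.starProjection (V.starProjection e)) w = 0 :=
        Submodule.inner_right_of_mem_orthogonal (U.starProjection_apply_mem _) hwU
      rw [h4, h5, add_zero]
  rw [h2, norm_sq_starProjection_orthogonal, hU]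

end Projections

/-! ### The coboundary as a matrix, the module property and the rank formula -/

namespace BasicConstruction

open WeightedL2 CoxeterSystem

variable {B W : Type*} [Group W] {M : CoxeterMatrix B} {cs : CoxeterSystem M W} {q : B → ℝ}
  {X : Type*} [TopologicalSpace X] {Z : Set X} [CWComplex Z]
  {mirror : B → RelCWComplex.Subcomplex Z} {n : ℕ}
  {inc : ∀ n : ℕ, RelCWComplex.cell Z n → RelCWComplex.cell Z (n + 1) → ℤ}

/-- `‖p_V e_c‖²` for the closure of a space `V` of cochains and the cell `1 c` of `U`. -/
noncomputable def localDim (V : Submodule ℝ (Cochain cs mirror q n))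
    (c : RelCWComplex.cell Z n) : ℝ :=
  ‖V.topologicalClosure.starProjection
    (basisVec (cellWeight cs mirror q n) (translate cs mirror 1 c))‖ ^ 2

theorem localDim_nonneg (V : Submodule ℝ (Cochain cs mirror q n)) (c : RelCWComplex.cell Z n) :
    0 ≤ localDim V c := sq_nonneg _

theorem localDim_orthogonal (hq : ∀ i, 0 < q i) (V : Submodule ℝ (Cochain cs mirror q n))
    (c : RelCWComplex.cell Z n) : localDim Vᗮ c = 1 - localDim V c := by
  have h : Vᗮ.topologicalClosure = V.topologicalClosureᗮ := by
    rw [Submodule.orthogonal_closure]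
    exact (Submodule.isClosed_orthogonal V).submodule_topologicalClosure_eq
  simp only [localDim, h]
  rw [norm_sq_starProjection_orthogonal, norm_basisVec (cellWeight_pos hq n), cellWeight_translate_one]

variable [CWComplex.Finite Z]

open Classical in
/-- The coboundary, transported to `⨁_c L²_q(W)`: a matrix of scalars. -/
noncomputable def matrixCoboundary (cs : CoxeterSystem M W) (mirror : B → RelCWComplex.Subcomplex Z)
    (inc : ∀ n : ℕ, RelCWComplex.cell Z n → RelCWComplex.cell Z (n + 1) → ℤ) (q : B → ℝ) (n : ℕ) :
    WeightedL2 (cs.sumWeight q (RelCWComplex.cell Z n)) →L[ℝ]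
      WeightedL2 (cs.sumWeight q (RelCWComplex.cell Z (n + 1))) :=
  ∑ c : RelCWComplex.cell Z n, ∑ c' : RelCWComplex.cell Z (n + 1),
    (inc n c c' * (√(cs.growth q (cellType mirror c)) / √(cs.growth q (cellType mirror c')))) •
      weightedComp (C := 1) (fun p : RelCWComplex.cell Z (n + 1) × W => if p.1 = c' then 1 else 0)
        (fun p => (c, p.2)) (fun p => by split_ifs <;> simp) (fun p hp p' hp' h => by
          have h1 : p.1 = c' := by
            by_contra h0
            simp [h0] at hp
          have h2 : p'.1 = c' := by
            by_contra h0
            simp [h0] at hp'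
          exact Prod.ext (h1.trans h2.symm) (Prod.mk.inj h).2)

theorem matrixCoboundary_apply (x : WeightedL2 (cs.sumWeight q (RelCWComplex.cell Z n)))
    (p : RelCWComplex.cell Z (n + 1) × W) :
    (matrixCoboundary cs mirror inc q n x : ∀ _ : RelCWComplex.cell Z (n + 1) × W, ℝ) p =
      ∑ c, (inc n c p.1 * (√(cs.growth q (cellType mirror c)) /
        √(cs.growth q (cellType mirror p.1)))) *
          (x : ∀ _ : RelCWComplex.cell Z n × W, ℝ) (c, p.2) := by
  classical
  simp only [matrixCoboundary, _root_.sum_apply, lp.coeFn_sum, Finset.sum_apply]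
  refine Finset.sum_congr rfl fun c _ => ?_
  rw [Finset.sum_eq_single p.1]
  · change _ * ((if p.1 = p.1 then (1 : ℝ) else 0) * _) = _
    rw [if_pos rfl, one_mul]
  · intro c' _ hc'
    change _ * ((if p.1 = c' then (1 : ℝ) else 0) * _) = _
    rw [if_neg hc'.symm, zero_mul, mul_zero]
  · exact fun h => absurd (Finset.mem_univ _) h

/-- The matrix mixes the summands by real scalars, whereas $e_s$ acts in the same way on every
summand. -/
theorem heckeCommute_matrixCoboundary :
    cs.HeckeCommute q (matrixCoboundary cs mirror inc q n) := by
  intro i x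
  ext p
  simp only [matrixCoboundary_apply, heckeOp_apply, Finset.mul_sum, ← Finset.sum_add_distrib]
  refine Finset.sum_congr rfl fun c _ => ?_
  ring

variable [T2Space X] {o : CellOrientation Z}

/-- Incidence gives $S(c')\subseteq S(c)$, so cosets of $W_{S(c')}$ lie in cosets of $W_{S(c)}$.
Hence the shortest representative in `coboundary` may be replaced by any other. -/
theorem translate_eq_of_inc_ne_zero (hinc : IsCellularIncidence o inc)
    {c : RelCWComplex.cell Z n} {c' : RelCWComplex.cell Z (n + 1)} (h : inc n c c' ≠ 0) {w w' : W}
    (hw : translate cs mirror w c' = translate cs mirror w' c') :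
    translate cs mirror w c = translate cs mirror w' c := by
  simp only [translate, Sigma.mk.injEq, heq_eq_eq, true_and, QuotientGroup.eq] at hw ⊢
  exact Subgroup.closure_mono (Set.image_mono (hinc.cellType_subset mirror h)) hw

theorem coboundary_translate (hinc : IsCellularIncidence o inc) (f : Cell cs mirror n → ℝ) (w : W)
    (c' : RelCWComplex.cell Z (n + 1)) :
    coboundary cs mirror inc f (translate cs mirror w c') =
      ∑ c, (inc n c c' : ℝ) * f (translate cs mirror w c) := by
  rw [coboundary, finsum_eq_sum_of_fintype]
  refine Finset.sum_congr rfl fun c _ => ?_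
  by_cases h : inc n c c' = 0
  · simp [translate, h]
  · congr 2
    refine translate_eq_of_inc_ne_zero hinc h ?_
    simp only [translate, mk_shortest]

theorem coboundary_coboundary (hinc : IsCellularIncidence o inc) (f : Cell cs mirror n → ℝ) :
    coboundary cs mirror inc (coboundary cs mirror inc f) = fun _ => 0 := by
  funext σ
  obtain ⟨w, c, rfl⟩ := exists_translate_eq σ
  rw [coboundary_translate hinc]
  simp only [coboundary_translate hinc, Finset.mul_sum]
  rw [Finset.sum_comm]
  refine Finset.sum_eq_zero fun α _ => ?_
  simp only [← mul_assoc, ← Finset.sum_mul]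
  have h := hinc.sum_mul_eq_zero α c
  have h2 : ∑ β, (inc (n + 1) β c : ℝ) * (inc n α β : ℝ) = 0 := by exact_mod_cast h
  rw [h2, zero_mul]

theorem coboundaries_le_cocycles (hinc : IsCellularIncidence o inc) :
    coboundaries cs mirror inc q n ≤ cocycles cs mirror inc q n := by
  cases n with
  | zero => exact bot_le
  | succ n =>
    rintro x ⟨y, hy⟩
    change coboundary cs mirror inc (value cs mirror q x) = _
    rw [hy, coboundary_coboundary hinc]

section Embedding

variable (hq : ∀ i, 0 < q i) (hc : ∀ i j, IsConj (cs.simple i) (cs.simple j) → q i = q j)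
  (hm : WFinite cs mirror)

theorem coeff_matrixCoboundary_embedIso (hinc : IsCellularIncidence o inc)
    (x : Cochain cs mirror q n) (c' : RelCWComplex.cell Z (n + 1)) (w : W) :
    coeff (cs.sumWeight q _) (matrixCoboundary cs mirror inc q n (embedIso hq hc hm n x)) (c', w) =
      coboundary cs mirror inc (value cs mirror q x) (translate cs mirror w c') /
        √(cs.growth q (cellType mirror c')) := by
  rw [coboundary_translate hinc, coeff, matrixCoboundary_apply, Finset.sum_div, Finset.sum_div]
  refine Finset.sum_congr rfl fun c _ => ?_
  have h1 := coeff_embedIso hq hc hm x c w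
  rw [coeff] at h1
  dsimp only [sumWeight] at h1 ⊢
  rw [mul_div_assoc, h1]
  have h2 := (Real.sqrt_pos.2 (growth_pos hq hm c)).ne'
  have h3 := (Real.sqrt_pos.2 (growth_pos hq hm c')).ne'
  field_simp

theorem exists_embedIso_eq_matrixCoboundary (hinc : IsCellularIncidence o inc)
    (x : Cochain cs mirror q n) :
    ∃ z, embedIso hq hc hm (n + 1) z =
      matrixCoboundary cs mirror inc q n (embedIso hq hc hm n x) := by
  rw [exists_embedIso_eq_iff]
  intro c w v hv
  rw [coeff_matrixCoboundary_embedIso hq hc hm hinc, coeff_matrixCoboundary_embedIso hq hc hm hinc,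
    translate_mul w hv]

theorem embedIso_eq_matrixCoboundary_iff (hinc : IsCellularIncidence o inc)
    (x : Cochain cs mirror q n) (z : Cochain cs mirror q (n + 1)) :
    embedIso hq hc hm (n + 1) z = matrixCoboundary cs mirror inc q n (embedIso hq hc hm n x) ↔
      value cs mirror q z = coboundary cs mirror inc (value cs mirror q x) := by
  constructor
  · intro h
    funext σ
    obtain ⟨w, c, rfl⟩ := exists_translate_eq σ
    have h1 := congrArg (fun y => coeff (cs.sumWeight q _) y (c, w)) h
    rw [coeff_embedIso, coeff_matrixCoboundary_embedIso hq hc hm hinc,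
      div_left_inj' (Real.sqrt_pos.2 (growth_pos hq hm c)).ne'] at h1
    exact h1
  · intro h
    refine ext_coeff (sumWeight_pos hq _) ?_
    rintro ⟨c, w⟩
    rw [coeff_embedIso, coeff_matrixCoboundary_embedIso hq hc hm hinc, h]

theorem mem_cocycles_iff (hinc : IsCellularIncidence o inc) (x : Cochain cs mirror q n) :
    x ∈ cocycles cs mirror inc q n ↔
      matrixCoboundary cs mirror inc q n (embedIso hq hc hm n x) = 0 := by
  have h := embedIso_eq_matrixCoboundary_iff hq hc hm hinc x 0
  have h0 : value cs mirror q (0 : Cochain cs mirror q (n + 1)) = fun _ => 0 :=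
    funext fun β => coeff_zero _ β
  rw [map_zero, h0] at h
  rw [eq_comm, h, eq_comm]
  rfl

theorem mem_coboundaries_iff (hinc : IsCellularIncidence o inc)
    (z : Cochain cs mirror q (n + 1)) :
    z ∈ coboundaries cs mirror inc q (n + 1) ↔
      ∃ x, embedIso hq hc hm (n + 1) z =
        matrixCoboundary cs mirror inc q n (embedIso hq hc hm n x) := by
  simp only [embedIso_eq_matrixCoboundary_iff hq hc hm hinc]
  rfl

end Embedding

theorem isClosed_cocycles (hq : ∀ i, 0 < q i)
    (hc : ∀ i j, IsConj (cs.simple i) (cs.simple j) → q i = q j)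
    (hm : WFinite cs mirror) (hinc : IsCellularIncidence o inc) :
    IsClosed (cocycles cs mirror inc q n : Set (Cochain cs mirror q n)) := by
  have h : (cocycles cs mirror inc q n : Set (Cochain cs mirror q n)) =
      {x | matrixCoboundary cs mirror inc q n (embedIso hq hc hm n x) = 0} :=
    Set.ext fun x => mem_cocycles_iff hq hc hm hinc x
  rw [h]
  exact isClosed_eq ((matrixCoboundary cs mirror inc q n).continuous.comp
    (embedIso hq hc hm n).continuous) continuous_const

theorem isHilbertModule_embed_reducedCohomology (hq : ∀ i, 0 < q i)
    (hc : ∀ i j, IsConj (cs.simple i) (cs.simple j) → q i = q j)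
    (hm : WFinite cs mirror) (hinc : IsCellularIncidence o inc) :
    cs.IsHilbertModule q (embed cs mirror q (reducedCohomology cs mirror inc q n)) := by
  constructor
  · rw [embed_eq_map hq hc hm, Submodule.map_coe]
    refine (embedIso hq hc hm n).isometry.isClosedEmbedding.isClosedMap _ ?_
    exact (isClosed_cocycles hq hc hm hinc).inter (Submodule.isClosed_orthogonal _)
  · intro i y hy
    refine ⟨cs.heckeOp q _ i y, ?_, fun j w => coeff_heckeOp hq hc i y j w⟩
    rw [embed_eq_map hq hc hm] at hy ⊢
    obtain ⟨x, ⟨hx1, hx2⟩, rfl⟩ := hy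
    obtain ⟨x', hx'⟩ := exists_embedIso_eq_heckeOp hq hc hm i x
    refine ⟨x', ⟨?_, ?_⟩, hx'⟩
    · rw [SetLike.mem_coe, mem_cocycles_iff hq hc hm hinc] at hx1 ⊢
      rw [hx', heckeCommute_matrixCoboundary, hx1, map_zero]
    -- Orthogonality to coboundaries is preserved because $e_s$ is self-adjoint and maps
    -- coboundaries to coboundaries; in degree $0$ the coboundaries vanish.
    · cases n with
      | zero => simp [coboundaries]
      | succ n =>
        rw [SetLike.mem_coe, Submodule.mem_orthogonal] at hx2 ⊢
        intro z hz
        obtain ⟨y, hy⟩ := (mem_coboundaries_iff hq hc hm hinc z).1 hz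
        obtain ⟨y', hy'⟩ := exists_embedIso_eq_heckeOp hq hc hm i y
        obtain ⟨z', hz'⟩ := exists_embedIso_eq_matrixCoboundary hq hc hm hinc y'
        rw [← (embedIso hq hc hm (n + 1)).inner_map_map, hx', ← inner_heckeOp, hy,
          ← heckeCommute_matrixCoboundary, ← hy', ← hz', (embedIso hq hc hm (n + 1)).inner_map_map]
        exact hx2 z' ((mem_coboundaries_iff hq hc hm hinc z').2 ⟨y', hz'⟩)

/-- The rank formula: the coimage and the closed image of the coboundary have the same dimension. -/
theorem sum_one_sub_localDim_cocycles (hq : ∀ i, 0 < q i)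
    (hc : ∀ i j, IsConj (cs.simple i) (cs.simple j) → q i = q j)
    (hm : WFinite cs mirror) (hinc : IsCellularIncidence o inc) (n : ℕ) :
    ∑ c : RelCWComplex.cell Z n, (1 - localDim (cocycles cs mirror inc q n) c) /
        cs.growth q (cellType mirror c) =
      ∑ c : RelCWComplex.cell Z (n + 1), localDim (coboundaries cs mirror inc q (n + 1)) c /
        cs.growth q (cellType mirror c) := by
  set K := cocycles cs mirror inc q n with hK
  -- The matrix also acts off the image of $\Phi$. Composing with the projection onto that image
  -- leaves exactly the coboundaries as range and $\Phi(K^\perp)$ as coimage.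
  set A := matrixCoboundary cs mirror inc q n ∘L embedProj hq hc hm with hA
  have hAc : cs.HeckeCommute q A :=
    (heckeCommute_embedProj hq hc hm).comp heckeCommute_matrixCoboundary
  have hrange : LinearMap.range A.toLinearMap =
      embed cs mirror q (coboundaries cs mirror inc q (n + 1)) := by
    rw [embed_eq_map hq hc hm]
    ext y
    constructor
    · rintro ⟨m, rfl⟩
      obtain ⟨z, hz⟩ := exists_embedIso_eq_matrixCoboundary hq hc hm hinc
        (ContinuousLinearMap.adjoint (embedIso hq hc hm n).toContinuousLinearMap m)
      exact ⟨z, (mem_coboundaries_iff hq hc hm hinc z).2 ⟨_, hz⟩, hz⟩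
    · rintro ⟨z, hz, rfl⟩
      obtain ⟨x, hx⟩ := (mem_coboundaries_iff hq hc hm hinc z).1 hz
      refine ⟨embedIso hq hc hm n x, Eq.trans ?_ hx.symm⟩
      change matrixCoboundary cs mirror inc q n (embedProj hq hc hm (embedIso hq hc hm n x)) = _
      rw [embedProj_apply, adjoint_embedIso_apply]
  have hker : (embed cs mirror q Kᗮ).topologicalClosureᗮ = LinearMap.ker A.toLinearMap := by
    rw [Submodule.orthogonal_closure, embed_eq_map hq hc hm]
    ext m
    have h1 : m ∈ LinearMap.ker A.toLinearMap ↔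
        ContinuousLinearMap.adjoint (embedIso hq hc hm n).toContinuousLinearMap m ∈ K := by
      rw [hK, mem_cocycles_iff hq hc hm hinc]
      rfl
    have h2 : K = Kᗮᗮ := by
      rw [Submodule.orthogonal_orthogonal_eq_closure]
      exact (isClosed_cocycles hq hc hm hinc).submodule_topologicalClosure_eq.symm
    rw [h1, h2, Submodule.mem_orthogonal, Submodule.mem_orthogonal, ← h2]
    constructor
    · intro h x hx
      rw [ContinuousLinearMap.adjoint_inner_right]
      exact h _ ⟨x, hx, rfl⟩
    · rintro h _ ⟨x, hx, rfl⟩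
      have h3 := h x hx
      rwa [ContinuousLinearMap.adjoint_inner_right] at h3
  have h1 := hAc.vnTrace_coimage_eq hq hc _ hker (Submodule.isClosed_topologicalClosure _)
  rw [hrange] at h1
  have h2 := vnDim_embed hq hc hm Kᗮ
  have h3 := vnDim_embed hq hc hm (coboundaries cs mirror inc q (n + 1))
  rw [vnDim] at h2 h3
  rw [h2, h3] at h1
  refine Eq.trans (Finset.sum_congr rfl fun c _ => ?_) h1
  rw [← localDim_orthogonal hq]
  rfl

theorem betti_eq_sum (hq : ∀ i, 0 < q i)
    (hc : ∀ i j, IsConj (cs.simple i) (cs.simple j) → q i = q j)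
    (hm : WFinite cs mirror) (hinc : IsCellularIncidence o inc) (n : ℕ) :
    betti cs mirror inc q n = ∑ c : RelCWComplex.cell Z n,
      (localDim (cocycles cs mirror inc q n) c - localDim (coboundaries cs mirror inc q n) c) /
        cs.growth q (cellType mirror c) := by
  rw [betti, vnDim_embed hq hc hm]
  refine Finset.sum_congr rfl fun c _ => ?_
  congr 1
  have hK := (isClosed_cocycles (n := n) hq hc hm hinc).submodule_topologicalClosure_eq
  have h1 : (reducedCohomology cs mirror inc q n).topologicalClosure =
      (cocycles cs mirror inc q n).topologicalClosure ⊓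
        (coboundaries cs mirror inc q n).topologicalClosureᗮ := by
    rw [Submodule.orthogonal_closure, hK]
    refine IsClosed.submodule_topologicalClosure_eq ?_
    exact (isClosed_cocycles hq hc hm hinc).inter (Submodule.isClosed_orthogonal _)
  have h2 : (coboundaries cs mirror inc q n).topologicalClosure ≤
      (cocycles cs mirror inc q n).topologicalClosure :=
    Submodule.topologicalClosure_mono (coboundaries_le_cocycles hinc)
  have h3 : ((cocycles cs mirror inc q n).topologicalClosure ⊓
      (coboundaries cs mirror inc q n).topologicalClosureᗮ).HasOrthogonalProjection :=
    h1 ▸ inferInstance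
  rw [localDim, localDim, ← norm_sq_starProjection_inf_orthogonal _ _ h2]
  simp only [h1]

end BasicConstruction

/-! ### Comparison of weights and continuity from monotonicity -/

namespace WeightedL2

variable {ι : Type*} {μ μ' : ι → ℝ}

/-- `L²(ι, μ') ⊆ L²(ι, μ)` contractively if `μ ≤ μ'`. -/
theorem exists_coeff_eq_of_le (hμ : ∀ c, 0 < μ c) (h : ∀ c, μ c ≤ μ' c) (x : WeightedL2 μ') :
    ∃ y : WeightedL2 μ, coeff μ y = coeff μ' x ∧ ‖y‖ ≤ ‖x‖ := by
  have hx := norm_sq_eq_tsum (fun c => (hμ c).trans_le (h c)) x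
  have hle : ∀ c, coeff μ' x c ^ 2 * μ c ≤ coeff μ' x c ^ 2 * μ' c := fun c =>
    mul_le_mul_of_nonneg_left (h c) (sq_nonneg _)
  obtain ⟨y, hy⟩ := exists_coeff_eq μ hμ (coeff μ' x)
    (hx.summable.of_nonneg_of_le (fun c => mul_nonneg (sq_nonneg _) (hμ c).le) hle)
  refine ⟨y, hy, ?_⟩
  have hy2 := norm_sq_eq_tsum hμ y
  rw [hy] at hy2
  exact (sq_le_sq₀ (norm_nonneg _) (norm_nonneg _)).1 (hasSum_le hle hy2 hx)

/-- Multiplication by `μ / μ'` is a contraction from `L²(ι, μ)` to `L²(ι, μ')` if `μ ≤ μ'`. -/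
theorem exists_coeff_eq_mul_div (hμ : ∀ c, 0 < μ c) (h : ∀ c, μ c ≤ μ' c) (x : WeightedL2 μ) :
    ∃ y : WeightedL2 μ', (∀ c, coeff μ' y c = coeff μ x c * (μ c / μ' c)) ∧ ‖y‖ ≤ ‖x‖ := by
  have hμ' : ∀ c, 0 < μ' c := fun c => (hμ c).trans_le (h c)
  have hx := norm_sq_eq_tsum hμ x
  have hle : ∀ c, (coeff μ x c * (μ c / μ' c)) ^ 2 * μ' c ≤ coeff μ x c ^ 2 * μ c := by
    intro c
    have h1 : (coeff μ x c * (μ c / μ' c)) ^ 2 * μ' c =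
        coeff μ x c ^ 2 * μ c * (μ c / μ' c) := by
      have := (hμ' c).ne'
      field_simp
    rw [h1]
    refine mul_le_of_le_one_right (mul_nonneg (sq_nonneg _) (hμ c).le) ?_
    exact (div_le_one (hμ' c)).2 (h c)
  obtain ⟨y, hy⟩ := exists_coeff_eq μ' hμ' (fun c => coeff μ x c * (μ c / μ' c))
    (hx.summable.of_nonneg_of_le (fun c => mul_nonneg (sq_nonneg _) (hμ' c).le) hle)
  refine ⟨y, congrFun hy, ?_⟩
  have hy2 := norm_sq_eq_tsum hμ' y
  rw [hy] at hy2
  exact (sq_le_sq₀ (norm_nonneg _) (norm_nonneg _)).1 (hasSum_le hle hy2 hx)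

end WeightedL2

/-- If a positive combination of antitone bounded functions of several positive variables, with
continuous coefficients, is continuous, then these functions are continuous. -/
theorem continuousOn_of_antitone_of_sum {I κ : Type*} [Fintype κ] {a γ : κ → (I → ℝ) → ℝ}
    {Γ : (I → ℝ) → ℝ}
    (hanti : ∀ k q q', (∀ j, 0 < q j) → q ≤ q' → a k q' ≤ a k q)
    (ha : ∀ k q, (∀ j, 0 < q j) → |a k q| ≤ 1)
    (hγ : ∀ k, ContinuousOn (γ k) {q | ∀ j, 0 < q j})
    (hγ0 : ∀ k q, (∀ j, 0 < q j) → 0 < γ k q)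
    (hΓ : ContinuousOn Γ {q | ∀ j, 0 < q j})
    (hsum : ∀ q, (∀ j, 0 < q j) → ∑ k, γ k q * a k q = Γ q) (k : κ) :
    ContinuousOn (a k) {q | ∀ j, 0 < q j} := by
  set S : Set (I → ℝ) := {q | ∀ j, 0 < q j} with hS
  intro q₀ hq₀
  -- The map $p$ will be the minimum or maximum with $q_0$, and $s=\pm1$ the sign that makes all
  -- differences of the $a_k$ nonnegative at once.
  have key : ∀ (p : (I → ℝ) → I → ℝ) (s : ℝ), Continuous p → p q₀ = q₀ → Set.MapsTo p S S →
      (∀ q ∈ S, ∀ k, 0 ≤ s * (a k (p q) - a k q₀)) →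
      Filter.Tendsto (fun q => s * (a k (p q) - a k q₀)) (𝓝[S] q₀) (𝓝 0) := by
    intro p s hp hp0 hpS hs
    have hpt : Filter.Tendsto p (𝓝[S] q₀) (𝓝[S] q₀) := by
      have := (hp.continuousWithinAt (s := S) (x := q₀)).tendsto_nhdsWithin hpS
      rwa [hp0] at this
    -- This expression equals $s\sum_k\gamma_k(q_0)(a_k(p(q))-a_k(q_0))$ but involves only
    -- continuous functions and the bounded factors $a_k$. It tends to $0$, and so does each
    -- nonnegative summand.
    have hdiff : Filter.Tendsto (fun q => s * ((Γ (p q) - Γ q₀) +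
        ∑ k, (γ k q₀ - γ k (p q)) * a k (p q))) (𝓝[S] q₀) (𝓝 0) := by
      have h1 : Filter.Tendsto (fun q => Γ (p q) - Γ q₀) (𝓝[S] q₀) (𝓝 0) := by
        have := ((hΓ q₀ hq₀).tendsto.comp hpt).sub_const (Γ q₀)
        rwa [sub_self] at this
      have h2 : ∀ k, Filter.Tendsto (fun q => (γ k q₀ - γ k (p q)) * a k (p q)) (𝓝[S] q₀)
          (𝓝 0) := by
        intro k
        have h3 : Filter.Tendsto (fun q => γ k q₀ - γ k (p q)) (𝓝[S] q₀) (𝓝 0) := by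
          have := ((hγ k q₀ hq₀).tendsto.comp hpt).const_sub (γ k q₀)
          rwa [sub_self] at this
        refine squeeze_zero_norm' ?_ (tendsto_zero_iff_norm_tendsto_zero.1 h3)
        filter_upwards [self_mem_nhdsWithin] with q hq
        rw [norm_mul]
        exact mul_le_of_le_one_right (norm_nonneg _) (ha k _ (hpS hq))
      have h4 := (h1.add (tendsto_finsetSum Finset.univ fun k _ => h2 k)).const_mul s
      simpa using h4
    have hγk := hγ0 k q₀ hq₀
    have hlim : Filter.Tendsto (fun q => (γ k q₀)⁻¹ * (s * ((Γ (p q) - Γ q₀) +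
        ∑ k, (γ k q₀ - γ k (p q)) * a k (p q)))) (𝓝[S] q₀) (𝓝 0) := by
      simpa using hdiff.const_mul (γ k q₀)⁻¹
    refine tendsto_of_tendsto_of_tendsto_of_le_of_le' tendsto_const_nhds hlim ?_ ?_
    · filter_upwards [self_mem_nhdsWithin] with q hq using hs q hq k
    · filter_upwards [self_mem_nhdsWithin] with q hq
      have h5 : (Γ (p q) - Γ q₀) + ∑ k, (γ k q₀ - γ k (p q)) * a k (p q) =
          ∑ k, γ k q₀ * (a k (p q) - a k q₀) := by
        rw [← hsum _ (hpS hq), ← hsum _ hq₀, ← Finset.sum_sub_distrib, ← Finset.sum_add_distrib]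
        exact Finset.sum_congr rfl fun k _ => by ring
      have h6 := Finset.single_le_sum (f := fun k => γ k q₀ * (s * (a k (p q) - a k q₀)))
        (fun k _ => mul_nonneg (hγ0 k q₀ hq₀).le (hs q hq k)) (Finset.mem_univ k)
      have h7 : s * ∑ k, γ k q₀ * (a k (p q) - a k q₀) =
          ∑ k, γ k q₀ * (s * (a k (p q) - a k q₀)) := by
        rw [Finset.mul_sum]
        exact Finset.sum_congr rfl fun k _ => by ring
      rw [h5, h7, le_inv_mul_iff₀ hγk]
      exact h6
  -- A point $q$ need not be comparable with $q_0$, so $a_k(q)$ is squeezed between the values at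
  -- $q\sqcup q_0$ and $q\sqcap q_0$, which are comparable with both.
  have hinf : ∀ q ∈ S, q ⊓ q₀ ∈ S := fun q hq j => lt_min (hq j) (hq₀ j)
  have hsup : ∀ q ∈ S, q ⊔ q₀ ∈ S := fun q hq j => lt_max_of_lt_left (hq j)
  have h1 := key (fun q => q ⊓ q₀) 1 (continuous_pi fun j => (continuous_apply j).min continuous_const) (inf_idem _) hinf
    fun q hq k => by
      rw [one_mul, sub_nonneg]
      exact hanti k _ _ (hinf q hq) inf_le_right
  have h2 := key (fun q => q ⊔ q₀) (-1) (continuous_pi fun j => (continuous_apply j).max continuous_const) (sup_idem _) hsup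
    fun q hq k => by
      have := hanti k _ _ hq₀ (le_sup_right : q₀ ≤ q ⊔ q₀)
      linarith
  have h1' : Filter.Tendsto (fun q => a k (q ⊓ q₀)) (𝓝[S] q₀) (𝓝 (a k q₀)) := by
    have := h1.add_const (a k q₀)
    simpa using this
  have h2' : Filter.Tendsto (fun q => a k (q ⊔ q₀)) (𝓝[S] q₀) (𝓝 (a k q₀)) := by
    have := h2.const_sub (a k q₀)
    simpa using this
  refine tendsto_of_tendsto_of_tendsto_of_le_of_le' h2' h1' ?_ ?_
  · filter_upwards [self_mem_nhdsWithin] with q hq using hanti k _ _ hq le_sup_left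
  · filter_upwards [self_mem_nhdsWithin] with q hq using hanti k _ _ (hinf q hq) inf_le_left

/-! ### Monotonicity and continuity of the local dimensions -/

namespace BasicConstruction

open WeightedL2 CoxeterSystem

variable {B W : Type*} [Group W] {M : CoxeterMatrix B} {cs : CoxeterSystem M W} {q q' : B → ℝ}
  {X : Type*} [TopologicalSpace X] {Z : Set X} [CWComplex Z]
  {mirror : B → RelCWComplex.Subcomplex Z} {n : ℕ}
  {inc : ∀ n : ℕ, RelCWComplex.cell Z n → RelCWComplex.cell Z (n + 1) → ℤ}

theorem localDim_le_one (hq : ∀ i, 0 < q i) (V : Submodule ℝ (Cochain cs mirror q n))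
    (c : RelCWComplex.cell Z n) : localDim V c ≤ 1 := by
  have h1 := localDim_orthogonal hq V c
  have h2 := localDim_nonneg Vᗮ c
  linarith

theorem localDim_le_of_contraction (hq : ∀ i, 0 < q i) (hq' : ∀ i, 0 < q' i)
    (V : Submodule ℝ (Cochain cs mirror q n)) (V' : Submodule ℝ (Cochain cs mirror q' n))
    (hV : IsClosed (V : Set (Cochain cs mirror q n))) (c : RelCWComplex.cell Z n)
    (h : ∀ x ∈ V, ∃ y ∈ V', ‖y‖ ≤ ‖x‖ ∧ value cs mirror q' y (translate cs mirror 1 c) =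
      value cs mirror q x (translate cs mirror 1 c)) : localDim V c ≤ localDim V' c := by
  have h' : ∀ x : Cochain cs mirror q n, ∃ y : Cochain cs mirror q' n, x ∈ V →
      y ∈ V' ∧ ‖y‖ ≤ ‖x‖ ∧ value cs mirror q' y (translate cs mirror 1 c) =
        value cs mirror q x (translate cs mirror 1 c) := by
    intro x
    by_cases hx : x ∈ V
    · obtain ⟨y, hy⟩ := h x hx
      exact ⟨y, fun _ => hy⟩
    · exact ⟨0, fun hx' => absurd hx' hx⟩
  choose θ hθ using h'
  have hmem : ∀ x ∈ V.topologicalClosure, x ∈ V := fun x hx => by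
    rwa [hV.submodule_topologicalClosure_eq] at hx
  refine pow_le_pow_left₀ (norm_nonneg _) (norm_starProjection_le_of_contraction _ _ _ _ θ ?_ ?_ ?_) 2
  · exact fun x hx => V'.le_topologicalClosure (hθ x (hmem x hx)).1
  · exact fun x hx => (hθ x (hmem x hx)).2.1
  · intro x hx
    rw [inner_basisVec_right (cellWeight_pos hq' n), inner_basisVec_right (cellWeight_pos hq n),
      cellWeight_translate_one, cellWeight_translate_one]
    exact congrArg (· * 1) (hθ x (hmem x hx)).2.2

variable [CWComplex.Finite Z]

/-- It is shown that the local dimension of the orthogonal complement increases. Multiplication by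
$\mu_{\mathbf q}/\mu_{\mathbf q'}$ leaves the pairing $\sum z\,x\,\mu$ unchanged, and $\mathbf
q'$-coboundaries are also $\mathbf q$-coboundaries, so it maps complement to complement. -/
theorem localDim_coboundaries_antitone (hq : ∀ i, 0 < q i) (hqq' : ∀ i, q i ≤ q' i)
    (c : RelCWComplex.cell Z n) :
    localDim (coboundaries cs mirror inc q' n) c ≤ localDim (coboundaries cs mirror inc q n) c := by
  have hq' : ∀ i, 0 < q' i := fun i => (hq i).trans_le (hqq' i)
  have hμ : ∀ m, ∀ σ : Cell cs mirror m, cellWeight cs mirror q m σ ≤ cellWeight cs mirror q' m σ :=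
    fun m σ => wordWeight_mono hq hqq' (cs.shortest σ.2)
  suffices h : localDim (coboundaries cs mirror inc q n)ᗮ c ≤
      localDim (coboundaries cs mirror inc q' n)ᗮ c by
    rw [localDim_orthogonal hq, localDim_orthogonal hq'] at h
    linarith
  refine localDim_le_of_contraction hq hq' _ _ (Submodule.isClosed_orthogonal _) c ?_
  intro x hx
  obtain ⟨y, hy, hle⟩ := exists_coeff_eq_mul_div (cellWeight_pos hq n) (hμ n) x
  refine ⟨y, ?_, hle, ?_⟩
  · cases n with
    | zero => simp [coboundaries]
    | succ n =>
      rw [Submodule.mem_orthogonal] at hx ⊢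
      rintro z ⟨u, hu⟩
      obtain ⟨z', hz', -⟩ := exists_coeff_eq_of_le (cellWeight_pos hq _) (hμ _) z
      obtain ⟨u', hu', -⟩ := exists_coeff_eq_of_le (cellWeight_pos hq _) (hμ _) u
      have h1 : z' ∈ coboundaries cs mirror inc q (n + 1) := by
        refine ⟨u', ?_⟩
        dsimp only [value] at hu ⊢
        rw [hz', hu', hu]
      rw [← hx z' h1]
      refine (hasSum_inner _ (cellWeight_pos hq' _) z y).unique ?_
      refine (hasSum_inner _ (cellWeight_pos hq _) z' x).congr_fun fun σ => ?_
      rw [hy, hz']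
      have := (cellWeight_pos (cs := cs) (mirror := mirror) hq' _ σ).ne'
      field_simp
  · dsimp only [value]
    rw [hy, cellWeight_translate_one, cellWeight_translate_one, div_one, mul_one]

variable [T2Space X] {o : CellOrientation Z}

/-- The coboundary formula does not involve $\mathbf q$, so the contractive inclusion $L^2_{\mathbf
q'}\subseteq L^2_{\mathbf q}$ maps cocycles to cocycles. -/
theorem localDim_cocycles_antitone (hq : ∀ i, 0 < q i) (hqq' : ∀ i, q i ≤ q' i)
    (hc : ∀ i j, IsConj (cs.simple i) (cs.simple j) → q' i = q' j)
    (hm : WFinite cs mirror) (hinc : IsCellularIncidence o inc) (c : RelCWComplex.cell Z n) :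
    localDim (cocycles cs mirror inc q' n) c ≤ localDim (cocycles cs mirror inc q n) c := by
  have hq' : ∀ i, 0 < q' i := fun i => (hq i).trans_le (hqq' i)
  refine localDim_le_of_contraction hq' hq _ _ (isClosed_cocycles hq' hc hm hinc) c ?_
  intro x hx
  obtain ⟨y, hy, hle⟩ := exists_coeff_eq_of_le (cellWeight_pos hq n)
    (fun σ => wordWeight_mono hq hqq' (cs.shortest σ.2)) x
  refine ⟨y, ?_, hle, congrFun hy _⟩
  change coboundary cs mirror inc (coeff _ y) = _
  rw [hy]
  exact hx

/-- The local dimensions of the cocycles and of the coboundaries are continuous in the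
multiparameter. -/
theorem continuousOn_localDim {I : Type*} (idx : B → I)
    (hidx : ∀ s t : B, IsConj (cs.simple s) (cs.simple t) → idx s = idx t)
    (hm : WFinite cs mirror) (hinc : IsCellularIncidence o inc) (n : ℕ) :
    (∀ c, ContinuousOn (fun q : I → ℝ =>
      localDim (cocycles cs mirror inc (fun s => q (idx s)) n) c) {q | ∀ j, 0 < q j}) ∧
    ∀ c, ContinuousOn (fun q : I → ℝ =>
      localDim (coboundaries cs mirror inc (fun s => q (idx s)) (n + 1)) c) {q | ∀ j, 0 < q j} := by
  have hc : ∀ q : I → ℝ, ∀ s t, IsConj (cs.simple s) (cs.simple t) → q (idx s) = q (idx t) :=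
    fun q s t h => congrArg q (hidx s t h)
  have hg : ∀ m, ∀ c : RelCWComplex.cell Z m, ContinuousOn (fun q : I → ℝ =>
      (cs.growth (fun s => q (idx s)) (cellType mirror c))⁻¹) {q | ∀ j, 0 < q j} := by
    intro m c
    have := hm.finite_special c
    exact (continuous_growth (fun s => continuous_apply (idx s)) _).continuousOn.inv₀
      fun q hq => (growth_pos (fun s => hq (idx s)) hm c).ne'
  -- The family is indexed by the cells of dimensions $n$ and $n+1$ together, since the rank formula
  -- controls only the joint sum.
  have key := continuousOn_of_antitone_of_sum
    (κ := RelCWComplex.cell Z n ⊕ RelCWComplex.cell Z (n + 1))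
    (a := Sum.elim
      (fun c (q : I → ℝ) => localDim (cocycles cs mirror inc (fun s => q (idx s)) n) c)
      fun c q => localDim (coboundaries cs mirror inc (fun s => q (idx s)) (n + 1)) c)
    (γ := Sum.elim
      (fun c (q : I → ℝ) => (cs.growth (fun s => q (idx s)) (cellType mirror c))⁻¹)
      fun c q => (cs.growth (fun s => q (idx s)) (cellType mirror c))⁻¹)
    (Γ := fun q => ∑ c : RelCWComplex.cell Z n,
      (cs.growth (fun s => q (idx s)) (cellType mirror c))⁻¹)
    (by
      rintro (c | c) q q' hq hqq'
      · exact localDim_cocycles_antitone (fun s => hq (idx s)) (fun s => hqq' (idx s)) (hc q') hm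
          hinc c
      · exact localDim_coboundaries_antitone (fun s => hq (idx s)) (fun s => hqq' (idx s)) c)
    (by
      rintro (c | c) q hq
      · exact abs_le.2 ⟨neg_one_lt_zero.le.trans (localDim_nonneg _ c),
          localDim_le_one (fun s => hq (idx s)) _ c⟩
      · exact abs_le.2 ⟨neg_one_lt_zero.le.trans (localDim_nonneg _ c),
          localDim_le_one (fun s => hq (idx s)) _ c⟩)
    (by
      rintro (c | c)
      · exact hg _ c
      · exact hg _ c)
    (by
      rintro (c | c) q hq
      · exact inv_pos.2 (growth_pos (fun s => hq (idx s)) hm c)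
      · exact inv_pos.2 (growth_pos (fun s => hq (idx s)) hm c))
    (continuousOn_finsetSum _ fun c _ => hg n c)
    (by
      intro q hq
      have h := sum_one_sub_localDim_cocycles (q := fun s => q (idx s)) (fun s => hq (idx s)) (hc q)
        hm hinc n
      rw [Fintype.sum_sum_type]
      simp only [Sum.elim_inl, Sum.elim_inr]
      simp only [div_eq_inv_mul] at h
      rw [← h, ← Finset.sum_add_distrib]
      exact Finset.sum_congr rfl fun c _ => by ring)
  exact ⟨fun c => key (Sum.inl c), fun c => key (Sum.inr c)⟩

theorem continuousOn_betti {I : Type*} (idx : B → I)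
    (hidx : ∀ s t : B, IsConj (cs.simple s) (cs.simple t) → idx s = idx t)
    (hm : WFinite cs mirror) (hinc : IsCellularIncidence o inc) (n : ℕ) :
    ContinuousOn (fun q : I → ℝ => betti cs mirror inc (fun s => q (idx s)) n)
      {q | ∀ j, 0 < q j} := by
  have hc : ∀ q : I → ℝ, ∀ s t, IsConj (cs.simple s) (cs.simple t) → q (idx s) = q (idx t) :=
    fun q s t h => congrArg q (hidx s t h)
  -- Coboundaries in positive degree are covered by the rank formula one degree lower; in degree $0$
  -- they are zero.
  have hcob : ∀ c, ContinuousOn (fun q : I → ℝ =>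
      localDim (coboundaries cs mirror inc (fun s => q (idx s)) n) c) {q | ∀ j, 0 < q j} := by
    cases n with
    | zero =>
      intro c
      refine (continuousOn_const (c := (0 : ℝ))).congr fun q _ => ?_
      have h : (coboundaries cs mirror inc (fun s => q (idx s)) 0).topologicalClosure = ⊥ :=
        IsClosed.submodule_topologicalClosure_eq isClosed_singleton
      simp [localDim, h]
    | succ n => exact (continuousOn_localDim idx hidx hm hinc n).2
  refine ContinuousOn.congr (f := fun q : I → ℝ => ∑ c : RelCWComplex.cell Z n,
      (localDim (cocycles cs mirror inc (fun s => q (idx s)) n) c -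
        localDim (coboundaries cs mirror inc (fun s => q (idx s)) n) c) /
          cs.growth (fun s => q (idx s)) (cellType mirror c)) ?_ fun q hq =>
    betti_eq_sum (fun s => hq (idx s)) (hc q) hm hinc n
  refine continuousOn_finsetSum _ fun c _ => ?_
  have := hm.finite_special c
  exact (((continuousOn_localDim idx hidx hm hinc n).1 c).sub (hcob c)).div
    (continuous_growth (fun s => continuous_apply (idx s)) _).continuousOn
    fun q hq => (growth_pos (fun s => hq (idx s)) hm c).ne'

end BasicConstruction

theorem theorem6p10 {B W I X : Type*} [Group W] {M : CoxeterMatrix B} (cs : CoxeterSystem M W)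
    (idx : B → I)
    (hidx : ∀ s t : B, IsConj (cs.simple s) (cs.simple t) → idx s = idx t)
    [TopologicalSpace X] [T2Space X] (Z : Set X) [CWComplex Z] [CWComplex.Finite Z]
    (mirror : B → RelCWComplex.Subcomplex Z)
    (hmirror : BasicConstruction.WFinite cs mirror)
    (o : CellOrientation Z)
    (inc : ∀ n : ℕ, RelCWComplex.cell Z n → RelCWComplex.cell Z (n + 1) → ℤ)
    (hinc : IsCellularIncidence o inc) (i : ℕ) :
    (∀ q : I → ℝ, (∀ j, 0 < q j) →
      cs.IsHilbertModule (fun s => q (idx s))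
        (BasicConstruction.embed cs mirror (fun s => q (idx s))
          (BasicConstruction.reducedCohomology cs mirror inc (fun s => q (idx s)) i))) ∧
    ContinuousOn (fun q : I → ℝ => BasicConstruction.betti cs mirror inc (fun s => q (idx s)) i)
      {q | ∀ j, 0 < q j} :=
  ⟨fun q hq => BasicConstruction.isHilbertModule_embed_reducedCohomology (fun s => hq (idx s))
      (fun s t h => congrArg q (hidx s t h)) hmirror hinc,
    BasicConstruction.continuousOn_betti idx hidx hmirror hinc i⟩
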